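/- Let $\phi(x,y,z)=\alpha x+\beta y+\gamma z$ with $\alpha,\beta,\gamma\in\mathbb{R}$ (possibly all zero). A surface in $\mathbb{R}^3$ with Gauss map $N$ and mean curvature $H$ is called $\phi$-minimal if $H_\phi=H-\frac12\frac{d\phi}{dN}$ vanishes everywhere on it. A cyclic surface is an immersed surface $X(s,t)=c(s)+r(s)\,(\cos t\,u(s)+\sin t\,v(s))$, $s\in I$, $t\in J$, swept out by a smooth one-parameter family of circles ($J=\mathbb{R}$) or of arcs of circles; here $I$ and $J$ are non-empty open intervals, $c$, $r>0$, $u$, $v$ are smooth on $I$, and $u(s),v(s)$ are orthonormal for each $s$. A surface is called rotational if it is a piece of a surface of revolution, that is, if there is a line such that the surface is locally invariant under rotations about this line; in particular, pieces of planes are rotational. Fix the interval $J$ (for instance $J=\mathbb{R}$, the case of full circles). Then a non-rotational cyclic $\phi$-minimal surface with $t$ ranging over $J$ exists if and only if $\phi=0$. Moreover, if $\phi=0$, then each such surface is, up to a rigid motion of $\mathbb{R}^3$, (a piece of) one of Riemann's classical minimal examples, that is, of a surface $$\{(x,y,z):\ z\in K,\ (x-a(z))^2+y^2=r(z)^2\},$$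 where $K$ is an open interval, $r>0$, and, for some constants $\lambda>0$ and $C\in\mathbb{R}$, $a'=\lambda r^2$, $r'^2=\lambda^2r^4+Cr^2-1$ and $r''=2\lambda^2r^3+Cr$ on $K$. -/

import Mathlib

open scoped ContDiff Topology InnerProductSpace

noncomputable section

/-- Euclidean three-space with its standard inner product. -/
abbrev E3 : Type := EuclideanSpace ℝ (Fin 3)

/-- The vector product of Euclidean three-space. -/
def cross (a b : E3) : E3 := WithLp.toLp 2 (crossProduct a.ofLp b.ofLp)

/-- Nonempty open intervals of the real line, bounded or not. -/
structure IsOpenInterval (I : Set ℝ) : Prop where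
  isOpen : IsOpen I
  ordConnected : I.OrdConnected
  nonempty : I.Nonempty

/-! ### Parametrized surfaces -/

/-- The partial derivative of `X(s, t)` in the first parameter. -/
def partialS (X : ℝ → ℝ → E3) (s t : ℝ) : E3 := deriv (fun x => X x t) s

/-- The partial derivative of `X(s, t)` in the second parameter. -/
def partialT (X : ℝ → ℝ → E3) (s t : ℝ) : E3 := deriv (fun y => X s y) t

/-- The Gauss map `N = (X_s × X_t) / |X_s × X_t|`. -/
def gaussMap (X : ℝ → ℝ → E3) (s t : ℝ) : E3 :=
  ‖cross (partialS X s t) (partialT X s t)‖⁻¹ • cross (partialS X s t) (partialT X s t)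

/-- The mean curvature `H = (e G - 2 f F + g E) / (2 (E G - F ^ 2))` with respect to `N`, where
`E, F, G` and `e, f, g` are the coefficients of the first and the second fundamental form. -/
def meanCurvature (X : ℝ → ℝ → E3) (s t : ℝ) : ℝ :=
  let E := ⟪partialS X s t, partialS X s t⟫_ℝ
  let F := ⟪partialS X s t, partialT X s t⟫_ℝ
  let G := ⟪partialT X s t, partialT X s t⟫_ℝ
  let e := ⟪partialS (partialS X) s t, gaussMap X s t⟫_ℝ
  let f := ⟪partialT (partialS X) s t, gaussMap X s t⟫_ℝ
  let g := ⟪partialT (partialT X) s t, gaussMap X s t⟫_ℝ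
  (e * G - 2 * f * F + g * E) / (2 * (E * G - F ^ 2))

/-- The mean curvature `H_φ = H - (1/2) dφ/dN` of a surface in the space with density `e ^ φ`. -/
def weightedMeanCurvature (φ : E3 → ℝ) (X : ℝ → ℝ → E3) (s t : ℝ) : ℝ :=
  meanCurvature X s t - 1 / 2 * fderiv ℝ φ (X s t) (gaussMap X s t)

/-- `φ`-minimality of the surface `X` on the parameter domain `I × J`: `H_φ = 0` everywhere. -/
def IsWeightedMinimal (φ : E3 → ℝ) (I J : Set ℝ) (X : ℝ → ℝ → E3) : Prop :=
  ∀ s ∈ I, ∀ t ∈ J, weightedMeanCurvature φ X s t = 0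

/-! ### Cyclic surfaces -/

/-- The restriction of `X` to `I × J` is a cyclic surface: an immersed surface swept out by a
smooth one-parameter family of circles (if `J = ℝ`, or as soon as `J` has length more than `2 π`)
or of arcs of circles. The circle with parameter `s` has centre `c s` and radius `ρ s`, and lies in
the plane through `c s` spanned by the orthonormal vectors `u s` and `v s`. -/
structure IsCyclicSurface (I J : Set ℝ) (X : ℝ → ℝ → E3) : Prop where
  interval_left : IsOpenInterval I
  interval_right : IsOpenInterval J
  circles : ∃ (c u v : ℝ → E3) (ρ : ℝ → ℝ),
    ContDiffOn ℝ ∞ c I ∧ ContDiffOn ℝ ∞ u I ∧ ContDiffOn ℝ ∞ v I ∧ ContDiffOn ℝ ∞ ρ I ∧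
    (∀ s ∈ I, 0 < ρ s ∧ ‖u s‖ = 1 ∧ ‖v s‖ = 1 ∧ ⟪u s, v s⟫_ℝ = 0) ∧
    ∀ s ∈ I, ∀ t ∈ J, X s t = c s + ρ s • (Real.cos t • u s + Real.sin t • v s)
  immersed : ∀ s ∈ I, ∀ t ∈ J, LinearIndependent ℝ ![partialS X s t, partialT X s t]

/-! ### Rotational surfaces -/

/-- The rotation of angle `θ` about the line through `p` with unit direction `w`. -/
def axisRotation (p w : E3) (θ : ℝ) (x : E3) : E3 :=
  p + (Real.cos θ • (x - p) + Real.sin θ • cross w (x - p)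
    + ((1 - Real.cos θ) * ⟪w, x - p⟫_ℝ) • w)

/-- The restriction of `X` to `I × J` is (a piece of) a surface of revolution: there is an axis
such that the surface is locally invariant under the rotations about that axis, that is, rotations
of small angle keep each point of the surface on the part of the surface near that point. (Only
small angles, since a piece of a surface of revolution, such as a disc in a plane with an
off-centre axis, need not contain the whole orbits of its points.) -/
def IsRotational (I J : Set ℝ) (X : ℝ → ℝ → E3) : Prop :=
  ∃ p w : E3, ‖w‖ = 1 ∧ ∀ s ∈ I, ∀ t ∈ J, ∀ U ∈ 𝓝 ((s, t) : ℝ × ℝ),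
    ∀ᶠ θ in 𝓝 (0 : ℝ), axisRotation p w θ (X s t) ∈ Function.uncurry X '' (U ∩ I ×ˢ J)

/-! ### Riemann's minimal examples -/

/-- Riemann's minimal surfaces in normal position, over an interval `K` of heights. The horizontal
slice at height `z` is the circle with centre `(a z, 0, z)` and radius `r z`, where
`a' = lam r ^ 2` and `r' ^ 2 = lam ^ 2 r ^ 4 + C r ^ 2 - 1` for constants `lam > 0` and `C`. The
differentiated equation `r'' = 2 lam ^ 2 r ^ 3 + C r` is included because it excludes the spurious
constant solutions `r` of the first order equation. -/
structure IsRiemannInNormalPosition (R : Set E3) : Prop where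
  profile : ∃ (lam C : ℝ) (K : Set ℝ) (a r r₁ : ℝ → ℝ), 0 < lam ∧ IsOpenInterval K ∧
    (∀ z ∈ K, 0 < r z ∧ HasDerivAt a (lam * r z ^ 2) z ∧ HasDerivAt r (r₁ z) z ∧
      HasDerivAt r₁ (2 * lam ^ 2 * r z ^ 3 + C * r z) z ∧
      r₁ z ^ 2 = lam ^ 2 * r z ^ 4 + C * r z ^ 2 - 1) ∧
    R = {x : E3 | x 2 ∈ K ∧ (x 0 - a (x 2)) ^ 2 + x 1 ^ 2 = r (x 2) ^ 2}

/-- The restriction of `X` to `I × J` is, up to a rigid motion, (a piece of) one of Riemann's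
minimal examples. -/
def IsRiemannExample (I J : Set ℝ) (X : ℝ → ℝ → E3) : Prop :=
  ∃ (R : Set E3) (g : E3 ≃ᵢ E3), IsRiemannInNormalPosition R ∧
    ∀ s ∈ I, ∀ t ∈ J, g (X s t) ∈ R

end

/-! ### The vector product and positively oriented orthonormal frames -/

/-! Let g be the constant gradient of φ. At each point use the frame formed by the radial direction,
the tangent of the circle and the normal n of its plane. There the numerator of H_φ becomes
`circleEquation`. Along one circle it is a trigonometric polynomial in t of degree at most four. A
polynomial with infinitely many roots on the unit circle is zero, so vanishing on any interval J
kills every Fourier coefficient (`trig_coeffs_eq_zero`, `VanishesOnCircle.coeffs`). This is why arcs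
are as good as full circles. Write κ, μ, η for the complex coefficients of the planar part of c', of
the turning of the planes and of the planar part of g, and h = ⟪c', n⟫.

The planes are parallel (`IsCircleFamily.deriv_planeNormal_eq_zero`). Degree 4 reads (κ² + ρ²μ²)ημ =
0. Suppose μ ≠ 0 somewhere. If κ² + ρ²μ² = 0 on an open set, then κ = ±iρμ with a constant sign
locally. Differentiating this relation and using degrees 3 and 2 gives ρ' = h = 0, after which
degree 1 is contradictory. So η = 0 nearby, that is, g is normal to planes that turn, whence g = 0.
But then degree 3 returns κ² + ρ²μ² = 0.

With n constant there are two sources of rotational surfaces: h = 0 throughout (a piece of a plane)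
and κ = 0 throughout (coaxial circles). If g ≠ 0, one of them occurs: wherever h ≠ 0, having κ ≠ 0
would force ρ' = 0 by degrees 3 and 2, and degree 0 excludes this
(`IsCircleFamily.isRotational_of_density_ne_zero`).

If g = 0, then h satisfies a linear homogeneous equation near each of its zeros, so it vanishes
everywhere or nowhere. In the latter case degree 1 says that the planar velocity of the centres is h
ρ² times a fixed vector. A zero vector means coaxial circles. Otherwise, with height as parameter,
degree 0 becomes an equation for the radius whose first integral is Riemann's
(`IsCircleFamily.isRiemannExample_of_frame`).

Conversely, for φ = 0 the Riemann surface with λ = 1 and C = 0 is written down explicitly. A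
rotational symmetry would make a Killing field tangent to it, which comparison of Fourier
coefficients rules out (`exists_nonrotational_minimal`). -/

lemma inner_eq_coords (a b : E3) : ⟪a, b⟫_ℝ = a 0 * b 0 + a 1 * b 1 + a 2 * b 2 := by
  rw [PiLp.inner_apply, Fin.sum_univ_three]
  simp only [RCLike.inner_apply, conj_trivial]
  ring

lemma cross_apply_zero (a b : E3) : cross a b 0 = a 1 * b 2 - a 2 * b 1 := by
  simp [cross, crossProduct]

lemma cross_apply_one (a b : E3) : cross a b 1 = a 2 * b 0 - a 0 * b 2 := by
  simp [cross, crossProduct]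

lemma cross_apply_two (a b : E3) : cross a b 2 = a 0 * b 1 - a 1 * b 0 := by
  simp [cross, crossProduct]

lemma E3.ext {a b : E3} (h0 : a 0 = b 0) (h1 : a 1 = b 1) (h2 : a 2 = b 2) : a = b := by
  ext i
  fin_cases i <;> assumption

lemma cross_add_left (a b c : E3) : cross (a + b) c = cross a c + cross b c := by
  apply E3.ext <;> simp [cross_apply_zero, cross_apply_one, cross_apply_two] <;> ring

lemma cross_add_right (a b c : E3) : cross a (b + c) = cross a b + cross a c := by
  apply E3.ext <;> simp [cross_apply_zero, cross_apply_one, cross_apply_two] <;> ring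

lemma cross_smul_left (r : ℝ) (a b : E3) : cross (r • a) b = r • cross a b := by
  apply E3.ext <;> simp [cross_apply_zero, cross_apply_one, cross_apply_two] <;> ring

lemma cross_smul_right (r : ℝ) (a b : E3) : cross a (r • b) = r • cross a b := by
  apply E3.ext <;> simp [cross_apply_zero, cross_apply_one, cross_apply_two] <;> ring

lemma cross_self_eq_zero (a : E3) : cross a a = 0 := by
  apply E3.ext <;> simp [cross_apply_zero, cross_apply_one, cross_apply_two] <;> ring

lemma cross_swap (a b : E3) : cross a b = -cross b a := by
  apply E3.ext <;> simp [cross_apply_zero, cross_apply_one, cross_apply_two] <;> ring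

lemma cross_cross_right (a b c : E3) : cross a (cross b c) = ⟪a, c⟫_ℝ • b - ⟪a, b⟫_ℝ • c := by
  apply E3.ext <;>
    simp [cross_apply_zero, cross_apply_one, cross_apply_two, inner_eq_coords] <;> ring

lemma inner_cross_self_left (a b : E3) : ⟪a, cross a b⟫_ℝ = 0 := by
  simp only [cross_apply_zero, cross_apply_one, cross_apply_two, inner_eq_coords]; ring

lemma inner_cross_self_right (a b : E3) : ⟪b, cross a b⟫_ℝ = 0 := by
  simp only [cross_apply_zero, cross_apply_one, cross_apply_two, inner_eq_coords]; ring

lemma inner_cross_cross (a b c d : E3) :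
    ⟪cross a b, cross c d⟫_ℝ = ⟪a, c⟫_ℝ * ⟪b, d⟫_ℝ - ⟪a, d⟫_ℝ * ⟪b, c⟫_ℝ := by
  simp only [cross_apply_zero, cross_apply_one, cross_apply_two, inner_eq_coords]; ring

/-- Positively oriented orthonormal frames of Euclidean space. -/
structure IsFrame (e f n : E3) : Prop where
  ee : ⟪e, e⟫_ℝ = 1
  ff : ⟪f, f⟫_ℝ = 1
  ef : ⟪e, f⟫_ℝ = 0
  eq_cross : n = cross e f

namespace IsFrame

variable {e f n : E3}

lemma fe (h : IsFrame e f n) : ⟪f, e⟫_ℝ = 0 := by rw [real_inner_comm]; exact h.ef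

lemma en (h : IsFrame e f n) : ⟪e, n⟫_ℝ = 0 := by rw [h.eq_cross]; exact inner_cross_self_left _ _

lemma fn (h : IsFrame e f n) : ⟪f, n⟫_ℝ = 0 := by rw [h.eq_cross]; exact inner_cross_self_right _ _

lemma ne (h : IsFrame e f n) : ⟪n, e⟫_ℝ = 0 := by rw [real_inner_comm]; exact h.en

lemma nf (h : IsFrame e f n) : ⟪n, f⟫_ℝ = 0 := by rw [real_inner_comm]; exact h.fn

lemma nn (h : IsFrame e f n) : ⟪n, n⟫_ℝ = 1 := by
  rw [h.eq_cross, inner_cross_cross, h.ee, h.ff, h.ef]; ring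

lemma cross_ef (h : IsFrame e f n) : cross e f = n := h.eq_cross.symm

lemma cross_fn (h : IsFrame e f n) : cross f n = e := by
  rw [h.eq_cross, cross_cross_right, h.ff, h.fe]; simp

lemma cross_ne (h : IsFrame e f n) : cross n e = f := by
  rw [cross_swap, h.eq_cross, cross_cross_right, h.ee, h.ef]; simp

lemma cross_nf (h : IsFrame e f n) : cross n f = -e := by
  rw [cross_swap, h.cross_fn]

lemma orthonormal (h : IsFrame e f n) : Orthonormal ℝ ![e, f, n] := by
  rw [orthonormal_iff_ite]
  intro i j
  fin_cases i <;> fin_cases j <;> simp [h.ee, h.ff, h.ef, h.fe, h.en, h.fn, h.ne, h.nf, h.nn,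
    -inner_self_eq_norm_sq_to_K]

/-- The orthonormal basis formed by a frame. -/
noncomputable def basis (h : IsFrame e f n) : OrthonormalBasis (Fin 3) ℝ E3 :=
  OrthonormalBasis.mk h.orthonormal (by
    have : LinearIndependent ℝ ![e, f, n] := h.orthonormal.linearIndependent
    rw [this.span_eq_top_of_card_eq_finrank' (by simp)])

lemma basis_apply (h : IsFrame e f n) (i : Fin 3) : h.basis i = ![e, f, n] i := by
  simp [basis]

lemma inner_eq (h : IsFrame e f n) (x y : E3) :
    ⟪x, y⟫_ℝ = ⟪x, e⟫_ℝ * ⟪y, e⟫_ℝ + ⟪x, f⟫_ℝ * ⟪y, f⟫_ℝ + ⟪x, n⟫_ℝ * ⟪y, n⟫_ℝ := by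
  have := h.basis.sum_inner_mul_inner x y
  rw [Fin.sum_univ_three] at this
  simp only [basis_apply, Matrix.cons_val_zero, Matrix.cons_val_one, Matrix.cons_val] at this
  rw [← this, real_inner_comm y e, real_inner_comm y f, real_inner_comm y n]

lemma expand (h : IsFrame e f n) (x : E3) :
    x = ⟪x, e⟫_ℝ • e + ⟪x, f⟫_ℝ • f + ⟪x, n⟫_ℝ • n := by
  have := h.basis.sum_repr' x
  rw [Fin.sum_univ_three] at this
  simp only [basis_apply, Matrix.cons_val_zero, Matrix.cons_val_one, Matrix.cons_val] at this
  rw [real_inner_comm x e, real_inner_comm x f, real_inner_comm x n] at this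
  exact this.symm

lemma ext (h : IsFrame e f n) {x y : E3} (h1 : ⟪x, e⟫_ℝ = ⟪y, e⟫_ℝ) (h2 : ⟪x, f⟫_ℝ = ⟪y, f⟫_ℝ)
    (h3 : ⟪x, n⟫_ℝ = ⟪y, n⟫_ℝ) : x = y := by
  rw [h.expand x, h.expand y, h1, h2, h3]

/-- Rotation of a frame about its third vector. -/
lemma rotate (h : IsFrame e f n) (t : ℝ) :
    IsFrame (Real.cos t • e + Real.sin t • f) (-Real.sin t • e + Real.cos t • f) n := by
  have hcs := Real.sin_sq_add_cos_sq t
  refine ⟨?_, ?_, ?_, ?_⟩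
  · simp only [inner_add_left, inner_add_right, real_inner_smul_left, real_inner_smul_right,
      h.ee, h.ff, h.ef, h.fe]
    linear_combination hcs
  · simp only [inner_add_left, inner_add_right, real_inner_smul_left, real_inner_smul_right,
      h.ee, h.ff, h.ef, h.fe]
    linear_combination hcs
  · simp only [inner_add_left, inner_add_right, real_inner_smul_left, real_inner_smul_right,
      h.ee, h.ff, h.ef, h.fe]
    ring
  · simp only [cross_add_left, cross_add_right, cross_smul_left, cross_smul_right,
      cross_self_eq_zero, h.cross_ef, cross_swap f e]
    have : n = (Real.sin t ^ 2 + Real.cos t ^ 2) • n := by rw [hcs, one_smul]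
    conv_lhs => rw [this]
    module

end IsFrame

/-! ### Mean curvature in terms of an orthonormal frame -/

/-- The numerator of the weighted mean curvature of a surface with `X_t = ρ f`, `X_tt = -ρ e`,
in terms of the components of the derivatives of `X` in the frame `e, f, n`. -/
lemma weightedMeanCurvature_eq_zero_iff {e f n g : E3} (h : IsFrame e f n) {φ : E3 → ℝ}
    {X : ℝ → ℝ → E3} {s t ρ : ℝ} (hρ : 0 < ρ) (hφ : ∀ p x, fderiv ℝ φ p x = ⟪g, x⟫_ℝ)
    (hXt : partialT X s t = ρ • f) (hXtt : partialT (partialT X) s t = -ρ • e)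
    (hAB : ⟪partialS X s t, e⟫_ℝ ^ 2 + ⟪partialS X s t, n⟫_ℝ ^ 2 ≠ 0) :
    weightedMeanCurvature φ X s t = 0 ↔
      ρ * (⟪partialS (partialS X) s t, n⟫_ℝ * ⟪partialS X s t, e⟫_ℝ
          - ⟪partialS (partialS X) s t, e⟫_ℝ * ⟪partialS X s t, n⟫_ℝ)
        - 2 * ⟪partialS X s t, f⟫_ℝ
          * (⟪partialT (partialS X) s t, n⟫_ℝ * ⟪partialS X s t, e⟫_ℝ
            - ⟪partialT (partialS X) s t, e⟫_ℝ * ⟪partialS X s t, n⟫_ℝ)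
        + (⟪partialS X s t, e⟫_ℝ ^ 2 + ⟪partialS X s t, f⟫_ℝ ^ 2 + ⟪partialS X s t, n⟫_ℝ ^ 2)
          * ⟪partialS X s t, n⟫_ℝ
        - ρ * (⟪partialS X s t, e⟫_ℝ ^ 2 + ⟪partialS X s t, n⟫_ℝ ^ 2)
          * (⟪g, n⟫_ℝ * ⟪partialS X s t, e⟫_ℝ - ⟪g, e⟫_ℝ * ⟪partialS X s t, n⟫_ℝ) = 0 := by
  set Xs := partialS X s t with hXs
  set A := ⟪Xs, e⟫_ℝ with hA
  set S := ⟪Xs, f⟫_ℝ with hS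
  set B := ⟪Xs, n⟫_ℝ with hB
  have hcross : cross Xs (ρ • f) = ρ • (A • n - B • e) := by
    conv_lhs => rw [h.expand Xs, ← hA, ← hS, ← hB]
    simp only [cross_add_left, cross_smul_left, cross_smul_right, cross_self_eq_zero, h.cross_ef,
      h.cross_nf]
    module
  have hpos : 0 < A ^ 2 + B ^ 2 := lt_of_le_of_ne (by positivity) (Ne.symm hAB)
  have hnorm : ‖ρ • (A • n - B • e)‖ ^ 2 = ρ ^ 2 * (A ^ 2 + B ^ 2) := by
    rw [← real_inner_self_eq_norm_sq]
    simp only [inner_sub_left, inner_sub_right, real_inner_smul_left, real_inner_smul_right,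
      h.ee, h.nn, h.en, h.ne]
    ring
  set W := ‖ρ • (A • n - B • e)‖ with hW
  have hWpos : 0 < W := by
    have : 0 < W ^ 2 := by rw [hnorm]; positivity
    exact (sq_pos_iff.1 this).lt_of_le' (norm_nonneg _)
  have hG : gaussMap X s t = W⁻¹ • (ρ • (A • n - B • e)) := by
    rw [gaussMap, ← hXs, hXt, hcross]
  have hss : ⟪Xs, Xs⟫_ℝ = A ^ 2 + S ^ 2 + B ^ 2 := by rw [h.inner_eq Xs Xs]; ring
  have hEG : (A ^ 2 + S ^ 2 + B ^ 2) * (ρ * (ρ * 1)) - (ρ * S) ^ 2 = W ^ 2 := by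
    rw [hnorm]; ring
  have hW0 := hWpos.ne'
  rw [weightedMeanCurvature, meanCurvature, hφ, hG, ← hXs, hXt, hXtt, hss]
  simp only [inner_sub_right, real_inner_smul_left, real_inner_smul_right, h.ee, h.en, h.ff, ← hS]
  rw [hEG]
  -- With W² = EG − F² = ρ²(A² + B²), the weighted curvature is the positive factor ρ²/(2W³) times
  -- the claimed numerator.
  have key : ∀ x1 x3 y1 y3 g1 g3 : ℝ,
      (W⁻¹ * (ρ * (A * x3 - B * x1)) * (ρ * (ρ * 1)) - 2 * (W⁻¹ * (ρ * (A * y3 - B * y1))) * (ρ * S)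
        + W⁻¹ * (ρ * (A * (-ρ * 0) - B * (-ρ * 1))) * (A ^ 2 + S ^ 2 + B ^ 2)) / (2 * W ^ 2)
        - 1 / 2 * (W⁻¹ * (ρ * (A * g3 - B * g1)))
      = ρ ^ 2 / (2 * W ^ 3) * (ρ * (x3 * A - x1 * B) - 2 * S * (y3 * A - y1 * B)
        + (A ^ 2 + S ^ 2 + B ^ 2) * B - ρ * (A ^ 2 + B ^ 2) * (g3 * A - g1 * B)) := by
    intro x1 x3 y1 y3 g1 g3
    have h2 : A ^ 2 + B ^ 2 = W ^ 2 / ρ ^ 2 := by rw [hnorm]; field_simp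
    rw [h2]
    field_simp
    ring
  rw [key]
  have : ρ ^ 2 / (2 * W ^ 3) ≠ 0 := by positivity
  simp only [mul_eq_zero, this, false_or]

/-! ### Moving frames -/

lemma ContDiffOn.hasDerivAt_deriv {E : Type*} [NormedAddCommGroup E] [NormedSpace ℝ E]
    {f : ℝ → E} {I : Set ℝ} (hf : ContDiffOn ℝ ∞ f I) (hI : IsOpen I) {s : ℝ} (hs : s ∈ I) :
    HasDerivAt f (deriv f s) s :=
  ((hf.differentiableOn (by simp)).differentiableAt (hI.mem_nhds hs)).hasDerivAt

lemma ContDiffOn.contDiffOn_deriv {E : Type*} [NormedAddCommGroup E] [NormedSpace ℝ E]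
    {f : ℝ → E} {I : Set ℝ} (hf : ContDiffOn ℝ ∞ f I) (hI : IsOpen I) :
    ContDiffOn ℝ ∞ (deriv f) I :=
  hf.deriv_of_isOpen hI (by simp)

lemma ContDiffOn.euclidean_coord {f : ℝ → E3} {I : Set ℝ} (hf : ContDiffOn ℝ ∞ f I) (i : Fin 3) :
    ContDiffOn ℝ ∞ (fun s => f s i) I :=
  (contDiffOn_euclidean.1 hf) i

lemma ContDiffOn.cross {f g : ℝ → E3} {I : Set ℝ} (hf : ContDiffOn ℝ ∞ f I)
    (hg : ContDiffOn ℝ ∞ g I) : ContDiffOn ℝ ∞ (fun s => cross (f s) (g s)) I := by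
  rw [contDiffOn_euclidean]
  intro i
  fin_cases i
  · exact (((hf.euclidean_coord 1).mul (hg.euclidean_coord 2)).sub
      ((hf.euclidean_coord 2).mul (hg.euclidean_coord 1))).congr fun s _ => cross_apply_zero _ _
  · exact (((hf.euclidean_coord 2).mul (hg.euclidean_coord 0)).sub
      ((hf.euclidean_coord 0).mul (hg.euclidean_coord 2))).congr fun s _ => cross_apply_one _ _
  · exact (((hf.euclidean_coord 0).mul (hg.euclidean_coord 1)).sub
      ((hf.euclidean_coord 1).mul (hg.euclidean_coord 0))).congr fun s _ => cross_apply_two _ _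

lemma HasDerivAt.congr_on {E : Type*} [NormedAddCommGroup E] [NormedSpace ℝ E]
    {f g : ℝ → E} {f' g' : E} {I : Set ℝ} {s : ℝ} (hf : HasDerivAt f f' s) (hg : HasDerivAt g g' s)
    (hI : IsOpen I) (hs : s ∈ I) (h : ∀ x ∈ I, f x = g x) : f' = g' := by
  have : f =ᶠ[𝓝 s] g := Filter.eventually_of_mem (hI.mem_nhds hs) h
  exact (hf.congr_of_eventuallyEq this.symm).unique hg

lemma inner_deriv_add_of_const {P Q : ℝ → E3} {P' Q' : E3} {k : ℝ} {I : Set ℝ} {s : ℝ}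
    (hP : HasDerivAt P P' s) (hQ : HasDerivAt Q Q' s) (hI : IsOpen I) (hs : s ∈ I)
    (h : ∀ x ∈ I, ⟪P x, Q x⟫_ℝ = k) : ⟪P s, Q'⟫_ℝ + ⟪P', Q s⟫_ℝ = 0 :=
  (hP.inner ℝ hQ).congr_on (hasDerivAt_const s k) hI hs h

/-- The structure equations of a smooth moving frame, up to second order. -/
structure FrameRelations (e f n e₁ f₁ n₁ e₂ n₂ : E3) : Prop where
  e₁e : ⟪e₁, e⟫_ℝ = 0
  e₁n : ⟪e₁, n⟫_ℝ = -⟪e, n₁⟫_ℝ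
  f₁e : ⟪f₁, e⟫_ℝ = -⟪e₁, f⟫_ℝ
  f₁f : ⟪f₁, f⟫_ℝ = 0
  f₁n : ⟪f₁, n⟫_ℝ = -⟪f, n₁⟫_ℝ
  n₁n : ⟪n₁, n⟫_ℝ = 0
  e₂e : ⟪e₂, e⟫_ℝ = -(⟪e₁, f⟫_ℝ ^ 2 + ⟪e, n₁⟫_ℝ ^ 2)
  e₂n : ⟪e₂, n⟫_ℝ = -2 * ⟪e₁, f⟫_ℝ * ⟪f, n₁⟫_ℝ - ⟪e, n₂⟫_ℝ

/-- Differentiate the orthonormality identities once, and ⟪E', E⟫ = 0 and ⟪E, N'⟫ + ⟪E', N⟫ = 0 a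
second time; the products of first derivatives that appear are expanded in the frame. -/
lemma frameRelations {E F N : ℝ → E3} {I : Set ℝ} (hI : IsOpen I) (hE : ContDiffOn ℝ ∞ E I)
    (hF : ContDiffOn ℝ ∞ F I) (hN : ContDiffOn ℝ ∞ N I)
    (h : ∀ s ∈ I, IsFrame (E s) (F s) (N s)) {s : ℝ} (hs : s ∈ I) :
    FrameRelations (E s) (F s) (N s) (deriv E s) (deriv F s) (deriv N s)
      (deriv (deriv E) s) (deriv (deriv N) s) := by
  have dE : ∀ x ∈ I, HasDerivAt E (deriv E x) x := fun x hx => hE.hasDerivAt_deriv hI hx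
  have dF : ∀ x ∈ I, HasDerivAt F (deriv F x) x := fun x hx => hF.hasDerivAt_deriv hI hx
  have dN : ∀ x ∈ I, HasDerivAt N (deriv N x) x := fun x hx => hN.hasDerivAt_deriv hI hx
  have dE₂ := (hE.contDiffOn_deriv hI).hasDerivAt_deriv hI hs
  have dN₂ := (hN.contDiffOn_deriv hI).hasDerivAt_deriv hI hs
  have ee : ∀ x ∈ I, ⟪deriv E x, E x⟫_ℝ = 0 := fun x hx => by
    have := inner_deriv_add_of_const (dE x hx) (dE x hx) hI hx fun y hy => (h y hy).ee
    rw [real_inner_comm] at this; linarith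
  have ff : ⟪deriv F s, F s⟫_ℝ = 0 := by
    have := inner_deriv_add_of_const (dF s hs) (dF s hs) hI hs fun y hy => (h y hy).ff
    rw [real_inner_comm] at this; linarith
  have nn : ⟪deriv N s, N s⟫_ℝ = 0 := by
    have := inner_deriv_add_of_const (dN s hs) (dN s hs) hI hs fun y hy => (h y hy).nn
    rw [real_inner_comm] at this; linarith
  have en : ∀ x ∈ I, ⟪E x, deriv N x⟫_ℝ + ⟪deriv E x, N x⟫_ℝ = 0 := fun x hx =>
    inner_deriv_add_of_const (dE x hx) (dN x hx) hI hx fun y hy => (h y hy).en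
  have fn : ⟪F s, deriv N s⟫_ℝ + ⟪deriv F s, N s⟫_ℝ = 0 :=
    inner_deriv_add_of_const (dF s hs) (dN s hs) hI hs fun y hy => (h y hy).fn
  have ef : ⟪E s, deriv F s⟫_ℝ + ⟪deriv E s, F s⟫_ℝ = 0 :=
    inner_deriv_add_of_const (dE s hs) (dF s hs) hI hs fun y hy => (h y hy).ef
  have e2e := inner_deriv_add_of_const dE₂ (dE s hs) hI hs ee
  have e2n := (((dE s hs).inner ℝ dN₂).add (dE₂.inner ℝ (dN s hs))).congr_on
    (hasDerivAt_const s (0 : ℝ)) hI hs en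
  have hes := ee s hs
  have hens := en s hs
  have p1 := (h s hs).inner_eq (deriv E s) (deriv E s)
  have p2 := (h s hs).inner_eq (deriv E s) (deriv N s)
  rw [hes] at p1 p2
  rw [nn, real_inner_comm (F s) (deriv N s)] at p2
  refine ⟨hes, by linarith, ?_, ff, by linarith, nn, ?_, ?_⟩
  · rw [real_inner_comm]; linarith
  · have : ⟪deriv E s, N s⟫_ℝ = -⟪E s, deriv N s⟫_ℝ := by linarith
    rw [this] at p1
    linarith
  · linarith

/-! ### Families of circles -/

/-- Smooth one-parameter families of circles, with centres `c s`, radii `ρ s`, and planes spanned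
by the orthonormal vectors `u s`, `v s`. -/
structure IsCircleFamily (I : Set ℝ) (c u v : ℝ → E3) (ρ : ℝ → ℝ) : Prop where
  isOpen : IsOpen I
  center : ContDiffOn ℝ ∞ c I
  fst : ContDiffOn ℝ ∞ u I
  snd : ContDiffOn ℝ ∞ v I
  radius : ContDiffOn ℝ ∞ ρ I
  pos : ∀ s ∈ I, 0 < ρ s
  frame : ∀ s ∈ I, IsFrame (u s) (v s) (cross (u s) (v s))

/-- The unit normal of the planes of a family of circles. -/
def planeNormal (u v : ℝ → E3) (s : ℝ) : E3 := cross (u s) (v s)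

/-- The radial direction of angle `t` in the plane spanned by `u s`, `v s`. -/
noncomputable def radial (u v : ℝ → E3) (t s : ℝ) : E3 := Real.cos t • u s + Real.sin t • v s

/-- The tangential direction at angle `t` in the plane spanned by `u s`, `v s`. -/
noncomputable def tangential (u v : ℝ → E3) (t s : ℝ) : E3 := -Real.sin t • u s + Real.cos t • v s

lemma hasDerivAt_radial (u v : ℝ → E3) (s t : ℝ) :
    HasDerivAt (fun y => radial u v y s) (tangential u v t s) t := by
  exact ((Real.hasDerivAt_cos t).smul_const (u s)).add ((Real.hasDerivAt_sin t).smul_const (v s))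

lemma hasDerivAt_tangential (u v : ℝ → E3) (s t : ℝ) :
    HasDerivAt (fun y => tangential u v y s) (-radial u v t s) t := by
  have := ((Real.hasDerivAt_sin t).neg.smul_const (u s)).add
    ((Real.hasDerivAt_cos t).smul_const (v s))
  refine this.congr_deriv ?_
  simp only [radial]
  module

namespace IsCircleFamily

variable {I : Set ℝ} {c u v : ℝ → E3} {ρ : ℝ → ℝ}

lemma contDiffOn_planeNormal (h : IsCircleFamily I c u v ρ) :
    ContDiffOn ℝ ∞ (planeNormal u v) I := h.fst.cross h.snd

lemma contDiffOn_radial (h : IsCircleFamily I c u v ρ) (t : ℝ) :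
    ContDiffOn ℝ ∞ (radial u v t) I :=
  (h.fst.const_smul (Real.cos t)).add (h.snd.const_smul (Real.sin t))

lemma contDiffOn_tangential (h : IsCircleFamily I c u v ρ) (t : ℝ) :
    ContDiffOn ℝ ∞ (tangential u v t) I :=
  (h.fst.const_smul (-Real.sin t)).add (h.snd.const_smul (Real.cos t))

lemma frame_rotate (h : IsCircleFamily I c u v ρ) (t : ℝ) {s : ℝ} (hs : s ∈ I) :
    IsFrame (radial u v t s) (tangential u v t s) (planeNormal u v s) :=
  (h.frame s hs).rotate t

lemma relations (h : IsCircleFamily I c u v ρ) (t : ℝ) {s : ℝ} (hs : s ∈ I) :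
    FrameRelations (radial u v t s) (tangential u v t s) (planeNormal u v s)
      (deriv (radial u v t) s) (deriv (tangential u v t) s) (deriv (planeNormal u v) s)
      (deriv (deriv (radial u v t)) s) (deriv (deriv (planeNormal u v)) s) :=
  frameRelations h.isOpen (h.contDiffOn_radial t) (h.contDiffOn_tangential t)
    h.contDiffOn_planeNormal (fun _ hx => h.frame_rotate t hx) hs

lemma deriv_radial (h : IsCircleFamily I c u v ρ) (t : ℝ) {s : ℝ} (hs : s ∈ I) :
    deriv (radial u v t) s = radial (deriv u) (deriv v) t s :=
  (((h.fst.hasDerivAt_deriv h.isOpen hs).const_smul (Real.cos t)).add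
    ((h.snd.hasDerivAt_deriv h.isOpen hs).const_smul (Real.sin t))).deriv

lemma deriv_tangential (h : IsCircleFamily I c u v ρ) (t : ℝ) {s : ℝ} (hs : s ∈ I) :
    deriv (tangential u v t) s = tangential (deriv u) (deriv v) t s :=
  (((h.fst.hasDerivAt_deriv h.isOpen hs).const_smul (-Real.sin t)).add
    ((h.snd.hasDerivAt_deriv h.isOpen hs).const_smul (Real.cos t))).deriv

end IsCircleFamily

/-- The surface swept out by a family of circles. -/
def IsSweptBy (I J : Set ℝ) (c u v : ℝ → E3) (ρ : ℝ → ℝ) (X : ℝ → ℝ → E3) : Prop :=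
  ∀ s ∈ I, ∀ t ∈ J, X s t = c s + ρ s • radial u v t s

namespace IsCircleFamily

variable {I J : Set ℝ} {c u v : ℝ → E3} {ρ : ℝ → ℝ} {X : ℝ → ℝ → E3} {s t : ℝ}

lemma partialT_eq (hX : IsSweptBy I J c u v ρ X) (hJ : IsOpen J) (hs : s ∈ I) (ht : t ∈ J) :
    partialT X s t = ρ s • tangential u v t s := by
  have h1 : (fun y => X s y) =ᶠ[𝓝 t] fun y => c s + ρ s • radial u v y s :=
    Filter.eventually_of_mem (hJ.mem_nhds ht) fun y hy => hX s hs y hy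
  rw [partialT, h1.deriv_eq]
  exact (((hasDerivAt_radial u v s t).const_smul (ρ s)).const_add (c s)).deriv

lemma partialT_partialT_eq (hX : IsSweptBy I J c u v ρ X) (hJ : IsOpen J)
    (hs : s ∈ I) (ht : t ∈ J) : partialT (partialT X) s t = -ρ s • radial u v t s := by
  have h1 : (fun y => partialT X s y) =ᶠ[𝓝 t] fun y => ρ s • tangential u v y s :=
    Filter.eventually_of_mem (hJ.mem_nhds ht) fun y hy => partialT_eq hX hJ hs hy
  rw [partialT, h1.deriv_eq]
  refine ((hasDerivAt_tangential u v s t).const_smul (ρ s)).deriv.trans ?_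
  simp

lemma hasDerivAt_swept (h : IsCircleFamily I c u v ρ) (hs : s ∈ I) (t : ℝ) :
    HasDerivAt (fun x => c x + ρ x • radial u v t x)
      (deriv c s + deriv ρ s • radial u v t s + ρ s • deriv (radial u v t) s) s := by
  refine ((h.center.hasDerivAt_deriv h.isOpen hs).add
    ((h.radius.hasDerivAt_deriv h.isOpen hs).smul
      ((h.contDiffOn_radial t).hasDerivAt_deriv h.isOpen hs))).congr_deriv ?_
  module

lemma partialS_eq (h : IsCircleFamily I c u v ρ) (hX : IsSweptBy I J c u v ρ X)
    (hs : s ∈ I) (ht : t ∈ J) :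
    partialS X s t
      = deriv c s + deriv ρ s • radial u v t s + ρ s • deriv (radial u v t) s := by
  have h1 : (fun x => X x t) =ᶠ[𝓝 s] fun x => c x + ρ x • radial u v t x :=
    Filter.eventually_of_mem (h.isOpen.mem_nhds hs) fun x hx => hX x hx t ht
  rw [partialS, h1.deriv_eq]
  exact (h.hasDerivAt_swept hs t).deriv

lemma partialS_partialS_eq (h : IsCircleFamily I c u v ρ) (hX : IsSweptBy I J c u v ρ X)
    (hs : s ∈ I) (ht : t ∈ J) :
    partialS (partialS X) s t
      = deriv (deriv c) s + deriv (deriv ρ) s • radial u v t s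
        + (2 * deriv ρ s) • deriv (radial u v t) s + ρ s • deriv (deriv (radial u v t)) s := by
  have h1 : (fun x => partialS X x t) =ᶠ[𝓝 s]
      fun x => deriv c x + deriv ρ x • radial u v t x + ρ x • deriv (radial u v t) x :=
    Filter.eventually_of_mem (h.isOpen.mem_nhds hs) fun x hx => h.partialS_eq hX hx ht
  rw [partialS, h1.deriv_eq]
  have hE := h.contDiffOn_radial t
  have := (((h.center.contDiffOn_deriv h.isOpen).hasDerivAt_deriv h.isOpen hs).add
    (((h.radius.contDiffOn_deriv h.isOpen).hasDerivAt_deriv h.isOpen hs).smul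
      (hE.hasDerivAt_deriv h.isOpen hs))).add
    ((h.radius.hasDerivAt_deriv h.isOpen hs).smul
      ((hE.contDiffOn_deriv h.isOpen).hasDerivAt_deriv h.isOpen hs))
  refine this.deriv.trans ?_
  module

lemma partialT_partialS_eq (h : IsCircleFamily I c u v ρ) (hX : IsSweptBy I J c u v ρ X)
    (hJ : IsOpen J) (hs : s ∈ I) (ht : t ∈ J) :
    partialT (partialS X) s t
      = deriv ρ s • tangential u v t s + ρ s • deriv (tangential u v t) s := by
  have h1 : (fun y => partialS X s y) =ᶠ[𝓝 t] fun y => deriv c s + deriv ρ s • radial u v y s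
      + ρ s • radial (deriv u) (deriv v) y s :=
    Filter.eventually_of_mem (hJ.mem_nhds ht) fun y hy => by
      simp only [h.partialS_eq hX hs hy, h.deriv_radial y hs]
  rw [partialT, h1.deriv_eq, h.deriv_tangential t hs]
  exact ((((hasDerivAt_radial u v s t).const_smul (deriv ρ s)).const_add (deriv c s)).add
    ((hasDerivAt_radial (deriv u) (deriv v) s t).const_smul (ρ s))).deriv

end IsCircleFamily

/-! ### The equation of weighted minimality -/

/-- The numerator of the weighted mean curvature of a surface swept out by circles. -/
def circleEquation (ρ r₁ r₂ h h₂ g₃ A b d K k₂ n₂ ge : ℝ) : ℝ :=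
  ρ * (A * (h₂ + 2 * r₁ * b + ρ * n₂) - (h + ρ * b) * (k₂ + r₂ - ρ * b ^ 2)) - 2 * ρ * A * d * K
    + K ^ 2 * (h + ρ * b)
    + (A ^ 2 + (h + ρ * b) ^ 2) * ((h + ρ * b) - ρ * g₃ * A + ρ * ge * (h + ρ * b))

namespace IsCircleFamily

variable {I J : Set ℝ} {c u v : ℝ → E3} {ρ : ℝ → ℝ} {X : ℝ → ℝ → E3} {s t : ℝ}

lemma inner_partialS_radial (h : IsCircleFamily I c u v ρ) (hX : IsSweptBy I J c u v ρ X)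
    (hs : s ∈ I) (ht : t ∈ J) :
    ⟪partialS X s t, radial u v t s⟫_ℝ = deriv ρ s + ⟪deriv c s, radial u v t s⟫_ℝ := by
  rw [h.partialS_eq hX hs ht]
  simp only [inner_add_left, real_inner_smul_left, (h.relations t hs).e₁e,
    (h.frame_rotate t hs).ee]
  ring

lemma inner_partialS_tangential (h : IsCircleFamily I c u v ρ) (hX : IsSweptBy I J c u v ρ X)
    (hs : s ∈ I) (ht : t ∈ J) :
    ⟪partialS X s t, tangential u v t s⟫_ℝ = ⟪deriv c s, tangential u v t s⟫_ℝ
      + ρ s * ⟪deriv (radial u v t) s, tangential u v t s⟫_ℝ := by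
  rw [h.partialS_eq hX hs ht]
  simp only [inner_add_left, real_inner_smul_left, (h.frame_rotate t hs).ef]
  ring

lemma inner_partialS_planeNormal (h : IsCircleFamily I c u v ρ) (hX : IsSweptBy I J c u v ρ X)
    (hs : s ∈ I) (ht : t ∈ J) :
    ⟪partialS X s t, planeNormal u v s⟫_ℝ = ⟪deriv c s, planeNormal u v s⟫_ℝ
      + ρ s * -⟪radial u v t s, deriv (planeNormal u v) s⟫_ℝ := by
  rw [h.partialS_eq hX hs ht]
  simp only [inner_add_left, real_inner_smul_left, (h.frame_rotate t hs).en,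
    (h.relations t hs).e₁n]
  ring

/-- X_t is a nonzero multiple of the tangential vector, so independence only asks that X_s have a
component orthogonal to it. -/
lemma linearIndependent_iff (h : IsCircleFamily I c u v ρ) (hX : IsSweptBy I J c u v ρ X)
    (hJ : IsOpen J) (hs : s ∈ I) (ht : t ∈ J) :
    LinearIndependent ℝ ![partialS X s t, partialT X s t] ↔
      ⟪partialS X s t, radial u v t s⟫_ℝ ^ 2 + ⟪partialS X s t, planeNormal u v s⟫_ℝ ^ 2 ≠ 0 := by
  have hρ := h.pos s hs
  have hf := h.frame_rotate t hs
  rw [LinearIndependent.pair_iff, partialT_eq hX hJ hs ht]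
  constructor
  · intro hli h0
    have h1 : ⟪partialS X s t, radial u v t s⟫_ℝ = 0 := by
      apply pow_eq_zero_iff two_ne_zero |>.1; nlinarith [sq_nonneg ⟪partialS X s t, radial u v t s⟫_ℝ,
        sq_nonneg ⟪partialS X s t, planeNormal u v s⟫_ℝ]
    have h2 : ⟪partialS X s t, planeNormal u v s⟫_ℝ = 0 := by
      apply pow_eq_zero_iff two_ne_zero |>.1; nlinarith [sq_nonneg ⟪partialS X s t, radial u v t s⟫_ℝ,
        sq_nonneg ⟪partialS X s t, planeNormal u v s⟫_ℝ]
    have := hli (ρ s) (-⟪partialS X s t, tangential u v t s⟫_ℝ) (by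
      have hx := hf.expand (partialS X s t)
      rw [h1, h2] at hx
      nth_rewrite 1 [hx]
      module)
    exact hρ.ne' this.1
  · intro hAB x y hxy
    have h1 := congrArg (fun w => ⟪w, radial u v t s⟫_ℝ) hxy
    have h2 := congrArg (fun w => ⟪w, planeNormal u v s⟫_ℝ) hxy
    have h3 := congrArg (fun w => ⟪w, tangential u v t s⟫_ℝ) hxy
    simp only [inner_add_left, real_inner_smul_left, hf.fe, hf.fn, hf.ff, inner_zero_left,
      mul_zero, add_zero, mul_one] at h1 h2 h3
    have hx : x = 0 := by
      by_contra hx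
      apply hAB
      rw [(mul_eq_zero.1 h1).resolve_left hx, (mul_eq_zero.1 h2).resolve_left hx]
      ring
    refine ⟨hx, ?_⟩
    rw [hx] at h3
    simpa [hρ.ne'] using h3

/-- The spinning rate of u, v inside their plane cancels: it only reparametrizes the circles. This
is why `circleEquation` does not contain it. -/
lemma isWeightedMinimal_iff (h : IsCircleFamily I c u v ρ) (hX : IsSweptBy I J c u v ρ X)
    (hJ : IsOpen J) (hs : s ∈ I) (ht : t ∈ J) {φ : E3 → ℝ} {g : E3}
    (hφ : ∀ p x, fderiv ℝ φ p x = ⟪g, x⟫_ℝ)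
    (hli : LinearIndependent ℝ ![partialS X s t, partialT X s t]) :
    weightedMeanCurvature φ X s t = 0 ↔
      circleEquation (ρ s) (deriv ρ s) (deriv (deriv ρ) s) ⟪deriv c s, planeNormal u v s⟫_ℝ
        ⟪deriv (deriv c) s, planeNormal u v s⟫_ℝ ⟪g, planeNormal u v s⟫_ℝ
        (deriv ρ s + ⟪deriv c s, radial u v t s⟫_ℝ)
        (-⟪radial u v t s, deriv (planeNormal u v) s⟫_ℝ)
        (-⟪tangential u v t s, deriv (planeNormal u v) s⟫_ℝ)
        ⟪deriv c s, tangential u v t s⟫_ℝ ⟪deriv (deriv c) s, radial u v t s⟫_ℝ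
        (-⟪radial u v t s, deriv (deriv (planeNormal u v)) s⟫_ℝ) ⟪g, radial u v t s⟫_ℝ = 0 := by
  have hf := h.frame_rotate t hs
  have hr := h.relations t hs
  rw [weightedMeanCurvature_eq_zero_iff hf (h.pos s hs) hφ (partialT_eq hX hJ hs ht)
    (partialT_partialT_eq hX hJ hs ht) ((h.linearIndependent_iff hX hJ hs ht).1 hli),
    h.inner_partialS_radial hX hs ht, h.inner_partialS_tangential hX hs ht,
    h.inner_partialS_planeNormal hX hs ht, h.partialS_partialS_eq hX hs ht,
    h.partialT_partialS_eq hX hJ hs ht]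
  simp only [inner_add_left, real_inner_smul_left, hf.ee, hf.fe, hf.fn, hf.en, hr.e₁e, hr.e₁n,
    hr.f₁e, hr.f₁n, hr.e₂e, hr.e₂n, circleEquation]
  refine Eq.congr_left ?_
  ring

end IsCircleFamily

/-! ### Trigonometric polynomials -/

lemma IsOpenInterval.infinite_exp {J : Set ℝ} (hJ : IsOpenInterval J) :
    ((fun t : ℝ => Complex.exp (t * Complex.I)) '' J).Infinite := by
  obtain ⟨t₀, ht₀⟩ := hJ.nonempty
  obtain ⟨δ, hδ, hball⟩ := Metric.isOpen_iff.1 hJ.isOpen t₀ ht₀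
  -- Length at most 1, hence less than 2π, makes t ↦ exp(it) injective on the subinterval.
  set m := min δ 1
  have hm : 0 < m := lt_min hδ one_pos
  have hsub : Set.Ioo t₀ (t₀ + m) ⊆ J := fun x hx => hball (by
    rw [Metric.mem_ball, Real.dist_eq, abs_lt]
    have := min_le_left δ 1
    exact ⟨by linarith [hx.1], by linarith [hx.2]⟩)
  refine Set.Infinite.mono (Set.image_mono hsub) ((Set.Ioo_infinite (by linarith)).image ?_)
  intro x hx y hy hxy
  obtain ⟨k, hk⟩ := Complex.exp_eq_exp_iff_exists_int.1 hxy
  have hk' : x = y + k * (2 * Real.pi) := by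
    have : ((x : ℂ)) * Complex.I = ((y + k * (2 * Real.pi) : ℝ) : ℂ) * Complex.I := by
      rw [hk]; push_cast; ring
    exact_mod_cast mul_right_cancel₀ Complex.I_ne_zero this
  have h1 : |x - y| < 1 := by
    have := min_le_right δ 1
    rw [abs_lt]
    exact ⟨by linarith [hx.1, hy.2], by linarith [hx.2, hy.1]⟩
  have hpi := Real.pi_gt_three
  have : k = 0 := by
    by_contra hne
    have h2 : (1 : ℝ) ≤ |(k : ℝ)| := by exact_mod_cast Int.one_le_abs hne
    rw [hk', add_sub_cancel_left, abs_mul, abs_of_pos (by positivity : (0:ℝ) < 2 * Real.pi)] at h1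
    nlinarith
  simpa [this] using hk'

/-- A trigonometric polynomial of degree at most four that vanishes on an interval is zero. -/
lemma trig_coeffs_eq_zero {J : Set ℝ} (hJ : IsOpenInterval J) (q : Fin 9 → ℂ)
    (h : ∀ t ∈ J, ∑ j, q j * Complex.exp (t * Complex.I) ^ (j : ℕ) = 0) : q = 0 := by
  -- Index j stands for frequency j − 4: the trigonometric polynomial has been multiplied by z⁴.
  have hp : (∑ j : Fin 9, Polynomial.C (q j) * Polynomial.X ^ (j : ℕ)) = 0 := by
    apply Polynomial.eq_zero_of_infinite_isRoot
    refine hJ.infinite_exp.mono ?_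
    rintro _ ⟨t, ht, rfl⟩
    simpa [Polynomial.IsRoot, Polynomial.eval_finsetSum] using h t ht
  funext j
  have := congrArg (fun p => Polynomial.coeff p (j : ℕ)) hp
  simpa [Polynomial.finsetSum_coeff, Polynomial.coeff_C_mul, Polynomial.coeff_X_pow,
    Fin.val_inj] using this

/-- The coefficient of `exp (i t)` in `a cos t + b sin t`. -/
noncomputable def trigCoeff (a b : ℝ) : ℂ := (a - b * Complex.I) / 2

lemma trigCoeff_eq_zero_iff {a b : ℝ} : trigCoeff a b = 0 ↔ a = 0 ∧ b = 0 := by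
  simp [trigCoeff, Complex.ext_iff]

lemma trigCoeff_mul_conj (a b : ℝ) : trigCoeff a b * trigCoeff a (-b) = ((a ^ 2 + b ^ 2 : ℝ) : ℂ) / 4 := by
  simp only [trigCoeff]; push_cast
  linear_combination (-(b:ℂ) ^ 2 / 4) * Complex.I_sq

lemma ofReal_cos_add_sin (a b t : ℝ) :
    ((a * Real.cos t + b * Real.sin t : ℝ) : ℂ) = trigCoeff a b * Complex.exp (t * Complex.I)
      + trigCoeff a (-b) * (Complex.exp (t * Complex.I))⁻¹ := by
  rw [← Complex.exp_neg, Complex.exp_mul_I, ← neg_mul, Complex.exp_mul_I, Complex.cos_neg,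
    Complex.sin_neg]
  simp only [trigCoeff]
  push_cast
  linear_combination ((b:ℂ) * Complex.sin t) * Complex.I_sq

lemma ofReal_deriv_cos_add_sin (a b t : ℝ) :
    ((-a * Real.sin t + b * Real.cos t : ℝ) : ℂ)
      = Complex.I * (trigCoeff a b * Complex.exp (t * Complex.I)
        - trigCoeff a (-b) * (Complex.exp (t * Complex.I))⁻¹) := by
  rw [← Complex.exp_neg, Complex.exp_mul_I, ← neg_mul, Complex.exp_mul_I, Complex.cos_neg,
    Complex.sin_neg]
  simp only [trigCoeff]
  push_cast
  linear_combination ((b:ℂ) * Complex.cos t - a * Complex.sin t) * Complex.I_sq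

/-- The circle equation along a circle, in terms of the components of its data. -/
def VanishesOnCircle (J : Set ℝ) (ρ r₁ r₂ h h₂ g₃ c₁ c₂ p q C₁ C₂ N₁ N₂ g₁ g₂ : ℝ) : Prop :=
  ∀ t ∈ J, circleEquation ρ r₁ r₂ h h₂ g₃ (r₁ + (c₁ * Real.cos t + c₂ * Real.sin t))
    (p * Real.cos t + q * Real.sin t) (-p * Real.sin t + q * Real.cos t)
    (-c₁ * Real.sin t + c₂ * Real.cos t) (C₁ * Real.cos t + C₂ * Real.sin t)
    (N₁ * Real.cos t + N₂ * Real.sin t) (g₁ * Real.cos t + g₂ * Real.sin t) = 0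

/-- Each varying quantity is a polynomial in z = exp(it) divided by z, and the equation has degree
at most four in them, so multiplication by z⁴ clears all denominators. -/
lemma circleEquation_numerator {ρ r₁ r₂ h h₂ g₃ A b d K k₂ n₂ ge : ℝ} {A' b' d' K' k' n' g' z : ℂ}
    (hz : z ≠ 0) (hA : (A : ℂ) = A' / z) (hb : (b : ℂ) = b' / z) (hd : (d : ℂ) = d' / z)
    (hK : (K : ℂ) = K' / z) (hk : (k₂ : ℂ) = k' / z) (hn : (n₂ : ℂ) = n' / z)
    (hg : (ge : ℂ) = g' / z) (H : circleEquation ρ r₁ r₂ h h₂ g₃ A b d K k₂ n₂ ge = 0) :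
    ρ * (A' * (h₂ * z + 2 * r₁ * b' + ρ * n') * z ^ 2
        - (h * z + ρ * b') * (k' * z + r₂ * z ^ 2 - ρ * b' ^ 2) * z) - 2 * ρ * A' * d' * K' * z
      + K' ^ 2 * (h * z + ρ * b') * z
      + (A' ^ 2 + (h * z + ρ * b') ^ 2) * (((h * z + ρ * b') - ρ * g₃ * A') * z
        + ρ * g' * (h * z + ρ * b')) = 0 := by
  have h1 := congrArg (fun x : ℝ => (x : ℂ)) H
  simp only [circleEquation] at h1
  push_cast at h1
  rw [hA, hb, hd, hK, hk, hn, hg] at h1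
  refine Eq.trans ?_ (mul_eq_zero_of_right (z ^ 4) h1)
  field_simp

/-- The nonnegative Fourier coefficients of the circle equation. The convolution factors are
`E = A ^ 2 + B ^ 2` and `G = B - ρ g₃ A + ρ ge B`. -/
lemma VanishesOnCircle.coeffs {J : Set ℝ} (hJ : IsOpenInterval J)
    {ρ r₁ r₂ h h₂ g₃ c₁ c₂ p q C₁ C₂ N₁ N₂ g₁ g₂ : ℝ}
    (H : VanishesOnCircle J ρ r₁ r₂ h h₂ g₃ c₁ c₂ p q C₁ C₂ N₁ N₂ g₁ g₂)
    {κ κ' μ μ' C ν ν' η η' E₀ E₁ E₁' E₂ E₂' G₀ G₁ G₁' G₂ G₂' : ℂ}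
    (hκ : κ = trigCoeff c₁ c₂) (hκ' : κ' = trigCoeff c₁ (-c₂))
    (hμ : μ = trigCoeff p q) (hμ' : μ' = trigCoeff p (-q))
    (hC : C = trigCoeff C₁ C₂)
    (hν : ν = trigCoeff N₁ N₂) (hν' : ν' = trigCoeff N₁ (-N₂))
    (hη : η = trigCoeff g₁ g₂) (hη' : η' = trigCoeff g₁ (-g₂))
    (hE₀ : E₀ = r₁ ^ 2 + h ^ 2 + 2 * κ * κ' + 2 * ρ ^ 2 * μ * μ')
    (hE₁ : E₁ = 2 * r₁ * κ + 2 * h * ρ * μ) (hE₁' : E₁' = 2 * r₁ * κ' + 2 * h * ρ * μ')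
    (hE₂ : E₂ = κ ^ 2 + ρ ^ 2 * μ ^ 2) (hE₂' : E₂' = κ' ^ 2 + ρ ^ 2 * μ' ^ 2)
    (hG₀ : G₀ = h - ρ * g₃ * r₁ + ρ ^ 2 * (η * μ' + η' * μ))
    (hG₁ : G₁ = ρ * μ - ρ * g₃ * κ + ρ * η * h) (hG₁' : G₁' = ρ * μ' - ρ * g₃ * κ' + ρ * η' * h)
    (hG₂ : G₂ = ρ ^ 2 * η * μ) (hG₂' : G₂' = ρ ^ 2 * η' * μ') :
    E₂ * G₂ = 0 ∧
    E₂ * G₁ + E₁ * G₂ + ρ ^ 3 * μ ^ 3 + ρ * κ ^ 2 * μ = 0 ∧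
    E₂ * G₀ + E₁ * G₁ + E₀ * G₂ + ρ * κ * (2 * r₁ * μ + ρ * ν) - ρ ^ 2 * μ * C + ρ ^ 2 * h * μ ^ 2
      + 2 * ρ * r₁ * μ * κ - κ ^ 2 * h = 0 ∧
    E₂ * G₁' + E₁ * G₀ + E₀ * G₁ + E₁' * G₂ + ρ * (κ * h₂ + r₁ * (2 * r₁ * μ + ρ * ν))
      - ρ * (ρ * μ * (r₂ - 2 * ρ * μ * μ') + h * C - ρ ^ 2 * μ' * μ ^ 2)
      - 2 * ρ * μ' * κ ^ 2 + 2 * κ * κ' * ρ * μ - κ ^ 2 * ρ * μ' = 0 ∧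
    E₂ * G₂' + E₁ * G₁' + E₀ * G₀ + E₁' * G₁ + E₂' * G₂
      + ρ * (r₁ * h₂ + κ * (2 * r₁ * μ' + ρ * ν') + κ' * (2 * r₁ * μ + ρ * ν))
      - ρ * (ρ * μ * trigCoeff C₁ (-C₂) + h * (r₂ - 2 * ρ * μ * μ') + ρ * μ' * C)
      - 2 * ρ * r₁ * (μ * κ' + μ' * κ) + 2 * κ * κ' * h = 0 := by
  set C' := trigCoeff C₁ (-C₂) with hC'
  -- The entries run from frequency −4 to 4. Primed letters are conjugate coefficients, so the first
  -- four entries mirror the last four.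
  have key := trig_coeffs_eq_zero hJ ![
    E₂' * G₂',
    E₂' * G₁' + E₁' * G₂' + ρ ^ 3 * μ' ^ 3 + ρ * κ' ^ 2 * μ',
    E₂' * G₀ + E₁' * G₁' + E₀ * G₂' + ρ * κ' * (2 * r₁ * μ' + ρ * ν') - ρ ^ 2 * μ' * C'
      + ρ ^ 2 * h * μ' ^ 2 + 2 * ρ * r₁ * μ' * κ' - κ' ^ 2 * h,
    E₂' * G₁ + E₁' * G₀ + E₀ * G₁' + E₁ * G₂' + ρ * (κ' * h₂ + r₁ * (2 * r₁ * μ' + ρ * ν'))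
      - ρ * (ρ * μ' * (r₂ - 2 * ρ * μ' * μ) + h * C' - ρ ^ 2 * μ * μ' ^ 2)
      - 2 * ρ * μ * κ' ^ 2 + 2 * κ' * κ * ρ * μ' - κ' ^ 2 * ρ * μ,
    E₂ * G₂' + E₁ * G₁' + E₀ * G₀ + E₁' * G₁ + E₂' * G₂
      + ρ * (r₁ * h₂ + κ * (2 * r₁ * μ' + ρ * ν') + κ' * (2 * r₁ * μ + ρ * ν))
      - ρ * (ρ * μ * C' + h * (r₂ - 2 * ρ * μ * μ') + ρ * μ' * C)
      - 2 * ρ * r₁ * (μ * κ' + μ' * κ) + 2 * κ * κ' * h,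
    E₂ * G₁' + E₁ * G₀ + E₀ * G₁ + E₁' * G₂ + ρ * (κ * h₂ + r₁ * (2 * r₁ * μ + ρ * ν))
      - ρ * (ρ * μ * (r₂ - 2 * ρ * μ * μ') + h * C - ρ ^ 2 * μ' * μ ^ 2)
      - 2 * ρ * μ' * κ ^ 2 + 2 * κ * κ' * ρ * μ - κ ^ 2 * ρ * μ',
    E₂ * G₀ + E₁ * G₁ + E₀ * G₂ + ρ * κ * (2 * r₁ * μ + ρ * ν) - ρ ^ 2 * μ * C + ρ ^ 2 * h * μ ^ 2
      + 2 * ρ * r₁ * μ * κ - κ ^ 2 * h,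
    E₂ * G₁ + E₁ * G₂ + ρ ^ 3 * μ ^ 3 + ρ * κ ^ 2 * μ,
    E₂ * G₂] (by
      intro t ht
      have hz : Complex.exp (t * Complex.I) ≠ 0 := Complex.exp_ne_zero _
      have hS : ∀ a b : ℝ, ((a * Real.cos t + b * Real.sin t : ℝ) : ℂ)
          = (trigCoeff a b * Complex.exp (t * Complex.I) ^ 2 + trigCoeff a (-b))
            / Complex.exp (t * Complex.I) := by
        intro a b; rw [ofReal_cos_add_sin]; field_simp
      have hL : ∀ a b c : ℝ, ((c + (a * Real.cos t + b * Real.sin t) : ℝ) : ℂ)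
          = (trigCoeff a b * Complex.exp (t * Complex.I) ^ 2 + trigCoeff a (-b)
              + c * Complex.exp (t * Complex.I)) / Complex.exp (t * Complex.I) := by
        intro a b c; rw [Complex.ofReal_add, hS]; field_simp; ring
      have hD : ∀ a b : ℝ, ((-a * Real.sin t + b * Real.cos t : ℝ) : ℂ)
          = Complex.I * (trigCoeff a b * Complex.exp (t * Complex.I) ^ 2 - trigCoeff a (-b))
            / Complex.exp (t * Complex.I) := by
        intro a b; rw [ofReal_deriv_cos_add_sin]; field_simp
      have h1 := circleEquation_numerator hz (hL _ _ _) (hS _ _) (hD _ _) (hD _ _) (hS _ _)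
        (hS _ _) (hS _ _) (H t ht)
      rw [← hκ, ← hκ', ← hμ, ← hμ', ← hC, ← hC', ← hν, ← hν', ← hη, ← hη'] at h1
      generalize Complex.exp (t * Complex.I) = z at h1
      simp only [Fin.sum_univ_succ, Fin.sum_univ_zero]
      simp only [Matrix.cons_val_zero, Matrix.cons_val_succ, Fin.val_zero, Fin.val_succ]
      clear hS hL hD hz hκ hκ' hμ hμ' hC hC' hν hν' hη hη'
      subst hE₀ hE₁ hE₁' hE₂ hE₂' hG₀ hG₁ hG₁' hG₂ hG₂'
      -- The tangential quantities d and K carry a factor i each; the correction replaces i² by −1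
      -- in the terms d K and K².
      linear_combination h1 + (2 * ρ * (κ * z ^ 2 + κ' + r₁ * z) * (μ * z ^ 2 - μ')
        * (κ * z ^ 2 - κ') * z - (κ * z ^ 2 - κ') ^ 2 * (h * z + ρ * (μ * z ^ 2 + μ')) * z)
        * Complex.I_sq)
  have h0 := fun j => congrFun key j
  exact ⟨h0 8, h0 7, h0 6, h0 5, h0 4⟩

/-! ### Consequences of the circle equation -/

lemma conj_trigCoeff (a b : ℝ) : (starRingEnd ℂ) (trigCoeff a b) = trigCoeff a (-b) := by
  rw [trigCoeff, trigCoeff, map_div₀, map_ofNat]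
  simp

lemma trigCoeff_zero : trigCoeff 0 0 = 0 := by simp [trigCoeff]

lemma trigCoeff_zero_neg : trigCoeff 0 (-0) = 0 := by simp [trigCoeff]

namespace VanishesOnCircle

variable {J : Set ℝ} {ρ r₁ r₂ h h₂ g₃ c₁ c₂ p q C₁ C₂ N₁ N₂ g₁ g₂ : ℝ}

/-- This is the coefficient of degree 4. -/
lemma eq_zero_or (hJ : IsOpenInterval J) (hρ : 0 < ρ)
    (H : VanishesOnCircle J ρ r₁ r₂ h h₂ g₃ c₁ c₂ p q C₁ C₂ N₁ N₂ g₁ g₂)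
    (hμ : trigCoeff p q ≠ 0) :
    trigCoeff g₁ g₂ = 0 ∨ trigCoeff c₁ c₂ ^ 2 + ρ ^ 2 * trigCoeff p q ^ 2 = 0 := by
  have hρ' : (ρ : ℂ) ≠ 0 := by exact_mod_cast hρ.ne'
  have := (H.coeffs hJ rfl rfl rfl rfl rfl rfl rfl rfl rfl rfl rfl rfl rfl rfl rfl rfl rfl rfl
    rfl).1
  simp only [mul_eq_zero, hμ, or_false, pow_eq_zero_iff two_ne_zero, hρ', false_or] at this
  exact this.symm

/-- Without density the coefficient of degree 3 is 2ρμ(κ² + ρ²μ²). -/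
lemma isotropic_of_density_eq_zero (hJ : IsOpenInterval J) (hρ : 0 < ρ)
    (H : VanishesOnCircle J ρ r₁ r₂ h h₂ 0 c₁ c₂ p q C₁ C₂ N₁ N₂ 0 0)
    (hμ : trigCoeff p q ≠ 0) :
    trigCoeff c₁ c₂ ^ 2 + ρ ^ 2 * trigCoeff p q ^ 2 = 0 := by
  have hρ' : (ρ : ℂ) ≠ 0 := by exact_mod_cast hρ.ne'
  have := (H.coeffs hJ rfl rfl rfl rfl rfl rfl rfl rfl rfl rfl rfl rfl rfl rfl rfl rfl rfl rfl
    rfl).2.1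
  rw [trigCoeff_zero] at this
  have h2 : (2 * ρ * trigCoeff p q) * (trigCoeff c₁ c₂ ^ 2 + ρ ^ 2 * trigCoeff p q ^ 2) = 0 := by
    rw [← this]; push_cast; ring
  exact (mul_eq_zero.1 h2).resolve_left (by simp [hρ', hμ])

/-- The hypothesis on C₁, C₂ is the derivative in s of κ = ιρμ. Degree 3 becomes 2ρ³μ²(h + ιr₁)η =
0. If h + ιr₁ ≠ 0, then η = 0 and degree 2 becomes ρ²μ²(h + ιr₁)(5 − 2ιρg₃) = 0, whose last factor
has real part 5. -/
lemma isotropic_first_order (hJ : IsOpenInterval J) (hρ : 0 < ρ)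
    (H : VanishesOnCircle J ρ r₁ r₂ h h₂ g₃ c₁ c₂ p q C₁ C₂ N₁ N₂ g₁ g₂)
    (hμ : trigCoeff p q ≠ 0) {ι : ℂ} (hι : ι = Complex.I ∨ ι = -Complex.I)
    (hκ : trigCoeff c₁ c₂ = ι * ρ * trigCoeff p q)
    (hC : trigCoeff C₁ C₂ = -h * trigCoeff p q + ι * r₁ * trigCoeff p q
      + ι * ρ * trigCoeff N₁ N₂) : r₁ = 0 ∧ h = 0 := by
  have hρ' : (ρ : ℂ) ≠ 0 := by exact_mod_cast hρ.ne'
  have hι2 : ι ^ 2 = -1 := by rcases hι with rfl | rfl <;> simp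
  suffices hm : (h : ℂ) + ι * r₁ = 0 by
    rcases hι with rfl | rfl <;> simpa [Complex.ext_iff, and_comm] using hm
  obtain ⟨-, e3, e2, -⟩ := H.coeffs hJ rfl rfl rfl rfl rfl rfl rfl rfl rfl rfl rfl rfl rfl rfl rfl
    rfl rfl rfl rfl
  rw [hκ, hC] at e2
  rw [hκ] at e3
  generalize trigCoeff p q = μ at *
  generalize trigCoeff g₁ g₂ = η at *
  by_contra hm
  have hη : η = 0 := by
    have : 2 * ρ ^ 3 * μ ^ 2 * (h + ι * r₁) * η = 0 := by
      linear_combination e3 - hι2 * (2 * ρ ^ 3 * μ ^ 3 + ρ ^ 2 * μ ^ 2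
        * (-ρ * g₃ * ι * ρ * μ + ρ * η * h))
    simpa [hρ', hμ, hm] using this
  have h5 : ρ ^ 2 * μ ^ 2 * (h + ι * r₁) * (5 - 2 * ι * ρ * g₃) = 0 := by
    rw [hη] at e2
    linear_combination e2 + (ρ ^ 3 * μ ^ 2 * g₃ * r₁ - ρ ^ 4 * μ ^ 3 * trigCoeff g₁ (-g₂)) * hι2
  have h6 : (5 : ℂ) - 2 * ι * ρ * g₃ ≠ 0 := by
    intro h0
    have := congrArg Complex.re h0
    rcases hι with rfl | rfl <;> simp at this
  simp [hρ', hμ, hm, h6] at h5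

/-- The coefficient of degree 1 is ρ²μ times a number whose real part is 3ρ(p² + q²), which is
positive because μ ≠ 0. -/
lemma not_isotropic (hJ : IsOpenInterval J) (hρ : 0 < ρ)
    (H : VanishesOnCircle J ρ 0 0 0 h₂ g₃ c₁ c₂ p q C₁ C₂ N₁ N₂ g₁ g₂)
    (hμ : trigCoeff p q ≠ 0) {ι : ℂ} (hι : ι = Complex.I ∨ ι = -Complex.I)
    (hκ : trigCoeff c₁ c₂ = ι * ρ * trigCoeff p q) : False := by
  have hρ' : (ρ : ℂ) ≠ 0 := by exact_mod_cast hρ.ne'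
  have hι2 : ι ^ 2 = -1 := by rcases hι with rfl | rfl <;> simp
  have hκ' : trigCoeff c₁ (-c₂) = -ι * ρ * trigCoeff p (-q) := by
    have := congrArg (starRingEnd ℂ) hκ
    rw [map_mul, map_mul, conj_trigCoeff, conj_trigCoeff, Complex.conj_ofReal] at this
    rw [this]
    rcases hι with rfl | rfl <;> simp
  have e1 := (H.coeffs hJ rfl rfl rfl rfl rfl rfl rfl rfl rfl rfl rfl rfl rfl rfl rfl rfl rfl rfl
    rfl).2.2.2.1
  have hmm := trigCoeff_mul_conj p q
  have hm0 : p ^ 2 + q ^ 2 ≠ 0 := by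
    intro h0
    apply hμ
    rw [trigCoeff_eq_zero_iff]
    constructor <;> nlinarith [sq_nonneg p, sq_nonneg q]
  rw [hκ, hκ'] at e1
  generalize trigCoeff p q = μ at *
  generalize trigCoeff p (-q) = μ' at *
  have h1 : ρ ^ 2 * μ * (ι * (h₂ - ρ ^ 2 * g₃ * (p ^ 2 + q ^ 2)) + 3 * ρ * (p ^ 2 + q ^ 2)) = 0 := by
    push_cast at hmm e1
    linear_combination e1 - (ρ ^ 2 * μ ^ 2 * (ρ * μ' + ρ ^ 2 * g₃ * ι * μ')
      - 2 * ρ ^ 2 * μ * μ' * (ρ * μ - ρ ^ 2 * g₃ * ι * μ) - 5 * ρ ^ 3 * μ' * μ ^ 2) * hι2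
      - 4 * ρ ^ 2 * μ * (3 * ρ - ι * ρ ^ 2 * g₃) * hmm
  have h2 : ι * (h₂ - ρ ^ 2 * g₃ * (p ^ 2 + q ^ 2)) + 3 * ρ * (p ^ 2 + q ^ 2) = 0 := by
    simpa [hρ', hμ] using h1
  have h3 : (3 : ℂ) * ρ * (p ^ 2 + q ^ 2) = ((3 * ρ * (p ^ 2 + q ^ 2) : ℝ) : ℂ) := by push_cast; ring
  have h4 : (h₂ : ℂ) - ρ ^ 2 * g₃ * (p ^ 2 + q ^ 2)
      = ((h₂ - ρ ^ 2 * g₃ * (p ^ 2 + q ^ 2) : ℝ) : ℂ) := by push_cast; ring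
  rw [h3, h4] at h2
  have := congrArg Complex.re h2
  have hre : 3 * ρ * (p ^ 2 + q ^ 2) = 0 := by
    rw [Complex.add_re, Complex.ofReal_re, Complex.re_mul_ofReal] at this
    rcases hι with rfl | rfl <;> simpa using this
  simp [hρ.ne', hm0] at hre

/-! Circles in parallel planes -/

/-- With μ = 0, degree 3 is ρκ²(hη − g₃κ); after inserting this relation, degree 2 reduces to
ρκ²g₃r₁ = 0. -/
lemma parallel_density (hJ : IsOpenInterval J) (hρ : 0 < ρ)
    (H : VanishesOnCircle J ρ r₁ r₂ h h₂ g₃ c₁ c₂ 0 0 C₁ C₂ 0 0 g₁ g₂)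
    (hκ : trigCoeff c₁ c₂ ≠ 0) :
    g₃ * trigCoeff c₁ c₂ = h * trigCoeff g₁ g₂ ∧ g₃ * r₁ = 0 := by
  have hρ' : (ρ : ℂ) ≠ 0 := by exact_mod_cast hρ.ne'
  obtain ⟨-, e3, e2, -⟩ := H.coeffs hJ rfl rfl rfl rfl rfl rfl rfl rfl rfl rfl rfl rfl rfl rfl rfl
    rfl rfl rfl rfl
  simp only [trigCoeff_zero, trigCoeff_zero_neg] at e3 e2
  generalize trigCoeff c₁ c₂ = κ at *
  generalize trigCoeff g₁ g₂ = η at *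
  have h1 : g₃ * κ = h * η := by
    have : ρ * κ ^ 2 * (h * η - g₃ * κ) = 0 := by linear_combination e3
    have := (mul_eq_zero.1 this).resolve_left (by simp [hρ', hκ])
    linear_combination -this
  refine ⟨h1, ?_⟩
  have : ρ * κ ^ 2 * (g₃ * r₁) = 0 := by linear_combination -e2 - 2 * r₁ * κ * ρ * h1
  have := (mul_eq_zero.1 this).resolve_left (by simp [hρ', hκ])
  exact_mod_cast this

/-- For stationary radius the constant coefficient is h(h² + c₁² + c₂²). -/
lemma parallel_contradiction (hJ : IsOpenInterval J)
    (H : VanishesOnCircle J ρ 0 0 h h₂ g₃ c₁ c₂ 0 0 C₁ C₂ 0 0 g₁ g₂)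
    (hh : h ≠ 0) : False := by
  have e0 := (H.coeffs hJ rfl rfl rfl rfl rfl rfl rfl rfl rfl rfl rfl rfl rfl rfl rfl rfl rfl rfl
    rfl).2.2.2.2
  simp only [trigCoeff_zero, trigCoeff_zero_neg] at e0
  have hk := trigCoeff_mul_conj c₁ c₂
  have : ((h * (h ^ 2 + (c₁ ^ 2 + c₂ ^ 2)) : ℝ) : ℂ) = 0 := by
    push_cast at hk e0 ⊢
    linear_combination e0 - 4 * h * hk
  have := mul_eq_zero.1 (Complex.ofReal_eq_zero.1 this)
  rcases this with h0 | h0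
  · exact hh h0
  · have : 0 < h ^ 2 := by positivity
    nlinarith [sq_nonneg c₁, sq_nonneg c₂]

/-- Degree 1 is ρh(r₁² + h²)η. -/
lemma parallel_coaxial (hJ : IsOpenInterval J) (hρ : 0 < ρ)
    (H : VanishesOnCircle J ρ r₁ r₂ h h₂ g₃ 0 0 0 0 0 0 0 0 g₁ g₂) (hh : h ≠ 0) :
    g₁ = 0 ∧ g₂ = 0 := by
  have hρ' : (ρ : ℂ) ≠ 0 := by exact_mod_cast hρ.ne'
  have hh' : (h : ℂ) ≠ 0 := by exact_mod_cast hh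
  have e1 := (H.coeffs hJ rfl rfl rfl rfl rfl rfl rfl rfl rfl rfl rfl rfl rfl rfl rfl rfl rfl rfl
    rfl).2.2.2.1
  simp only [trigCoeff_zero, trigCoeff_zero_neg] at e1
  rw [← trigCoeff_eq_zero_iff]
  have hpos : ((r₁ ^ 2 + h ^ 2 : ℝ) : ℂ) ≠ 0 := by
    rw [Ne, Complex.ofReal_eq_zero]; positivity
  have : (ρ * h * (r₁ ^ 2 + h ^ 2 : ℝ)) * trigCoeff g₁ g₂ = 0 := by
    push_cast at e1 ⊢
    linear_combination e1
  exact (mul_eq_zero.1 this).resolve_left (by simp only [mul_eq_zero, hρ', hh', hpos, or_self, not_false_eq_true])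

lemma parallel_planar (hJ : IsOpenInterval J) (hρ : 0 < ρ)
    (H : VanishesOnCircle J ρ r₁ r₂ 0 h₂ g₃ c₁ c₂ 0 0 C₁ C₂ 0 0 g₁ g₂)
    (hκ : trigCoeff c₁ c₂ ≠ 0) : g₃ = 0 := by
  have := (H.parallel_density hJ hρ hκ).1
  simpa [hκ] using this

/-- Only degrees 1 and 0 survive; the first two equations are the real and imaginary parts of degree
1. -/
lemma parallel_minimal (hJ : IsOpenInterval J)
    (H : VanishesOnCircle J ρ r₁ r₂ h h₂ 0 c₁ c₂ 0 0 C₁ C₂ 0 0 0 0) :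
    ρ * (h₂ * c₁ - h * C₁) + 2 * r₁ * h * c₁ = 0 ∧ ρ * (h₂ * c₂ - h * C₂) + 2 * r₁ * h * c₂ = 0 ∧
    (r₁ ^ 2 + h ^ 2 + (c₁ ^ 2 + c₂ ^ 2)) * h + ρ * (r₁ * h₂ - h * r₂) = 0 := by
  obtain ⟨-, -, -, e1, e0⟩ := H.coeffs hJ rfl rfl rfl rfl rfl rfl rfl rfl rfl rfl rfl rfl rfl rfl
    rfl rfl rfl rfl rfl
  simp only [trigCoeff_zero, trigCoeff_zero_neg] at e1 e0
  have hk := trigCoeff_mul_conj c₁ c₂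
  have h1 : trigCoeff (ρ * (h₂ * c₁ - h * C₁) + 2 * r₁ * h * c₁)
      (ρ * (h₂ * c₂ - h * C₂) + 2 * r₁ * h * c₂) = 0 := by
    simp only [trigCoeff] at e1 ⊢
    push_cast at e1 ⊢
    linear_combination e1
  obtain ⟨ha, hb⟩ := trigCoeff_eq_zero_iff.1 h1
  refine ⟨ha, hb, ?_⟩
  have : (((r₁ ^ 2 + h ^ 2 + (c₁ ^ 2 + c₂ ^ 2)) * h + ρ * (r₁ * h₂ - h * r₂) : ℝ) : ℂ) = 0 := by
    push_cast at hk e0 ⊢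
    linear_combination e0 - 4 * h * hk
  exact_mod_cast this

end VanishesOnCircle

/-! ### The planes of the circles are parallel -/

namespace IsCircleFamily

variable {I J : Set ℝ} {c u v : ℝ → E3} {ρ : ℝ → ℝ} {X : ℝ → ℝ → E3} {s : ℝ} {g : E3}

lemma mono (h : IsCircleFamily I c u v ρ) {U : Set ℝ} (hU : IsOpen U) (hUI : U ⊆ I) :
    IsCircleFamily U c u v ρ :=
  ⟨hU, h.center.mono hUI, h.fst.mono hUI, h.snd.mono hUI, h.radius.mono hUI,
    fun s hs => h.pos s (hUI hs), fun s hs => h.frame s (hUI hs)⟩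

/-- The circle equation for the circle with parameter `s` of a family of circles, in the space
whose density has the gradient `g`. -/
def CircleVanishing (J : Set ℝ) (c u v : ℝ → E3) (ρ : ℝ → ℝ) (g : E3) (s : ℝ) : Prop :=
  VanishesOnCircle J (ρ s) (deriv ρ s) (deriv (deriv ρ) s) ⟪deriv c s, planeNormal u v s⟫_ℝ
    ⟪deriv (deriv c) s, planeNormal u v s⟫_ℝ ⟪g, planeNormal u v s⟫_ℝ
    ⟪deriv c s, u s⟫_ℝ ⟪deriv c s, v s⟫_ℝ
    (-⟪u s, deriv (planeNormal u v) s⟫_ℝ) (-⟪v s, deriv (planeNormal u v) s⟫_ℝ)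
    ⟪deriv (deriv c) s, u s⟫_ℝ ⟪deriv (deriv c) s, v s⟫_ℝ
    (-⟪u s, deriv (deriv (planeNormal u v)) s⟫_ℝ) (-⟪v s, deriv (deriv (planeNormal u v)) s⟫_ℝ)
    ⟪g, u s⟫_ℝ ⟪g, v s⟫_ℝ

lemma circleVanishing_iff (h : IsCircleFamily I c u v ρ) (hX : IsSweptBy I J c u v ρ X)
    (hJ : IsOpen J) {φ : E3 → ℝ} (hφ : ∀ p x, fderiv ℝ φ p x = ⟪g, x⟫_ℝ)
    (hli : ∀ s ∈ I, ∀ t ∈ J, LinearIndependent ℝ ![partialS X s t, partialT X s t]) (hs : s ∈ I) :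
    (∀ t ∈ J, weightedMeanCurvature φ X s t = 0) ↔ CircleVanishing J c u v ρ g s := by
  refine forall₂_congr fun t ht => ?_
  rw [h.isWeightedMinimal_iff hX hJ hs ht hφ (hli s hs t ht)]
  simp only [radial, tangential, inner_add_left, inner_add_right, real_inner_smul_left,
    real_inner_smul_right]
  refine Eq.congr_left ?_
  congr 1 <;> ring

/-- The horizontal velocity of the centres, as a complex number. -/
noncomputable def centreVelocity (c u v : ℝ → E3) (s : ℝ) : ℂ :=
  trigCoeff ⟪deriv c s, u s⟫_ℝ ⟪deriv c s, v s⟫_ℝ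

/-- The angular velocity of the planes, as a complex number. -/
noncomputable def planeVelocity (u v : ℝ → E3) (s : ℝ) : ℂ :=
  trigCoeff (-⟪u s, deriv (planeNormal u v) s⟫_ℝ) (-⟪v s, deriv (planeNormal u v) s⟫_ℝ)

lemma _root_.ContinuousAt.trigCoeff {a b : ℝ → ℝ} (ha : ContinuousAt a s) (hb : ContinuousAt b s) :
    ContinuousAt (fun x => trigCoeff (a x) (b x)) s := by
  unfold _root_.trigCoeff
  exact ((Complex.continuous_ofReal.continuousAt.comp ha).sub
    ((Complex.continuous_ofReal.continuousAt.comp hb).mul continuousAt_const)).div_const _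

lemma continuousAt_centreVelocity (h : IsCircleFamily I c u v ρ) (hs : s ∈ I) :
    ContinuousAt (centreVelocity c u v) s := by
  have h1 := ((h.center.contDiffOn_deriv h.isOpen).hasDerivAt_deriv h.isOpen hs).continuousAt
  exact (h1.inner (𝕜 := ℝ) (h.fst.hasDerivAt_deriv h.isOpen hs).continuousAt).trigCoeff
    (h1.inner (𝕜 := ℝ) (h.snd.hasDerivAt_deriv h.isOpen hs).continuousAt)

lemma continuousAt_planeVelocity (h : IsCircleFamily I c u v ρ) (hs : s ∈ I) :
    ContinuousAt (planeVelocity u v) s := by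
  have h1 := ((h.contDiffOn_planeNormal.contDiffOn_deriv h.isOpen).hasDerivAt_deriv
    h.isOpen hs).continuousAt
  exact ((h.fst.hasDerivAt_deriv h.isOpen hs).continuousAt.inner (𝕜 := ℝ) h1).neg.trigCoeff
    ((h.snd.hasDerivAt_deriv h.isOpen hs).continuousAt.inner (𝕜 := ℝ) h1).neg

lemma frame_uv (h : IsCircleFamily I c u v ρ) (hs : s ∈ I) :
    IsFrame (u s) (v s) (planeNormal u v s) := h.frame s hs

lemma relations_uv (h : IsCircleFamily I c u v ρ) (hs : s ∈ I) :
    FrameRelations (u s) (v s) (planeNormal u v s) (deriv u s) (deriv v s)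
      (deriv (planeNormal u v) s) (deriv (deriv u) s) (deriv (deriv (planeNormal u v)) s) :=
  frameRelations h.isOpen h.fst h.snd h.contDiffOn_planeNormal (fun _ hx => h.frame_uv hx) hs

lemma deriv_planeNormal_eq_zero_iff (h : IsCircleFamily I c u v ρ) (hs : s ∈ I) :
    deriv (planeNormal u v) s = 0 ↔ planeVelocity u v s = 0 := by
  rw [planeVelocity, trigCoeff_eq_zero_iff, neg_eq_zero, neg_eq_zero]
  constructor
  · intro h0
    simp [h0]
  · rintro ⟨h1, h2⟩
    apply (h.frame_uv hs).ext
    · rw [real_inner_comm, h1, inner_zero_left]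
    · rw [real_inner_comm, h2, inner_zero_left]
    · rw [(h.relations_uv hs).n₁n, inner_zero_left]

/-- The hypotheses are κ = iερμ in real form. Differentiating them produces spinning terms of the
frame u, v on both sides, and these cancel. -/
lemma isotropic_second_order (h : IsCircleFamily I c u v ρ) {ε : ℝ}
    (h1 : ∀ s ∈ I, ⟪deriv c s, u s⟫_ℝ = -(ε * (ρ s * ⟪v s, deriv (planeNormal u v) s⟫_ℝ)))
    (h2 : ∀ s ∈ I, ⟪deriv c s, v s⟫_ℝ = ε * (ρ s * ⟪u s, deriv (planeNormal u v) s⟫_ℝ))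
    (hs : s ∈ I) :
    ⟪deriv (deriv c) s, u s⟫_ℝ
      = ⟪deriv c s, planeNormal u v s⟫_ℝ * ⟪u s, deriv (planeNormal u v) s⟫_ℝ
        - ε * deriv ρ s * ⟪v s, deriv (planeNormal u v) s⟫_ℝ
        - ε * ρ s * ⟪v s, deriv (deriv (planeNormal u v)) s⟫_ℝ ∧
    ⟪deriv (deriv c) s, v s⟫_ℝ
      = ⟪deriv c s, planeNormal u v s⟫_ℝ * ⟪v s, deriv (planeNormal u v) s⟫_ℝ
        + ε * deriv ρ s * ⟪u s, deriv (planeNormal u v) s⟫_ℝ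
        + ε * ρ s * ⟪u s, deriv (deriv (planeNormal u v)) s⟫_ℝ := by
  have hI := h.isOpen
  have dc := (h.center.contDiffOn_deriv hI).hasDerivAt_deriv hI hs
  have du := h.fst.hasDerivAt_deriv hI hs
  have dv := h.snd.hasDerivAt_deriv hI hs
  have dρ := h.radius.hasDerivAt_deriv hI hs
  have dn := (h.contDiffOn_planeNormal.contDiffOn_deriv hI).hasDerivAt_deriv hI hs
  have hf := h.frame_uv hs
  have hr := h.relations_uv hs
  have e1 := (dc.inner ℝ du).congr_on ((dρ.mul (dv.inner ℝ dn)).const_mul ε).neg hI hs h1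
  have e2 := (dc.inner ℝ dv).congr_on ((dρ.mul (du.inner ℝ dn)).const_mul ε) hI hs h2
  have a1 := hf.inner_eq (deriv c s) (deriv u s)
  have a2 := hf.inner_eq (deriv c s) (deriv v s)
  have a3 := hf.inner_eq (deriv v s) (deriv (planeNormal u v) s)
  have a4 := hf.inner_eq (deriv u s) (deriv (planeNormal u v) s)
  simp only [hr.e₁e, hr.e₁n, hr.f₁e, hr.f₁f, hr.f₁n, hr.n₁n,
    real_inner_comm (u s) (deriv (planeNormal u v) s),
    real_inner_comm (v s) (deriv (planeNormal u v) s), h1 s hs, h2 s hs] at a1 a2 a3 a4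
  rw [a1, a3] at e1
  rw [a2, a4] at e2
  constructor
  · linear_combination e1
  · linear_combination e2

/-- The relation holds on an open set, so it may be differentiated: this gives ρ' = h = 0
throughout, hence also ρ'' = 0, and `VanishesOnCircle.not_isotropic` applies. -/
lemma false_of_isotropic (hJ : IsOpenInterval J) (h : IsCircleFamily I c u v ρ)
    (H : ∀ s ∈ I, CircleVanishing J c u v ρ g s) (hs : s ∈ I)
    (hμ : ∀ s ∈ I, planeVelocity u v s ≠ 0) {ε : ℝ} (hε : ε = 1 ∨ ε = -1)
    (hκ : ∀ s ∈ I, centreVelocity c u v s = ε * Complex.I * ρ s * planeVelocity u v s) :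
    False := by
  have hι : (ε : ℂ) * Complex.I = Complex.I ∨ (ε : ℂ) * Complex.I = -Complex.I := by
    rcases hε with rfl | rfl <;> simp
  have h12 : ∀ s ∈ I, ⟪deriv c s, u s⟫_ℝ = -(ε * (ρ s * ⟪v s, deriv (planeNormal u v) s⟫_ℝ)) ∧
      ⟪deriv c s, v s⟫_ℝ = ε * (ρ s * ⟪u s, deriv (planeNormal u v) s⟫_ℝ) := by
    intro x hx
    have := hκ x hx
    simp only [centreVelocity, planeVelocity, trigCoeff] at this
    have hre := congrArg Complex.re this
    have him := congrArg Complex.im this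
    simp at hre him
    constructor <;> linarith
  have first : ∀ s ∈ I, deriv ρ s = 0 ∧ ⟪deriv c s, planeNormal u v s⟫_ℝ = 0 := by
    intro x hx
    refine (H x hx).isotropic_first_order hJ (h.pos x hx) (hμ x hx) hι (hκ x hx) ?_
    obtain ⟨e1, e2⟩ := h.isotropic_second_order (fun y hy => (h12 y hy).1)
      (fun y hy => (h12 y hy).2) hx
    rw [e1, e2]
    simp only [trigCoeff]
    push_cast
    linear_combination (-ε * (deriv ρ x * ⟪v x, deriv (planeNormal u v) x⟫_ℝ
      + ρ x * ⟪v x, deriv (deriv (planeNormal u v)) x⟫_ℝ) / 2 : ℂ) * Complex.I_sq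
  have hρ2 : deriv (deriv ρ) s = 0 :=
    ((h.radius.contDiffOn_deriv h.isOpen).hasDerivAt_deriv h.isOpen hs).congr_on
      (hasDerivAt_const s (0 : ℝ)) h.isOpen hs fun x hx => (first x hx).1
  have hs' := H s hs
  rw [CircleVanishing, (first s hs).1, (first s hs).2, hρ2] at hs'
  exact hs'.not_isotropic hJ (h.pos s hs) (hμ s hs) hι (hκ s hs)

lemma false_of_eventually_isotropic (hJ : IsOpenInterval J) (h : IsCircleFamily I c u v ρ)
    (H : ∀ s ∈ I, CircleVanishing J c u v ρ g s) (hs : s ∈ I) (hμ : planeVelocity u v s ≠ 0)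
    (hκ : ∀ᶠ x in 𝓝 s, centreVelocity c u v x ^ 2 + ρ x ^ 2 * planeVelocity u v x ^ 2 = 0) :
    False := by
  have cκ := h.continuousAt_centreVelocity hs
  have cμ := h.continuousAt_planeVelocity hs
  have cρ : ContinuousAt (fun x => (ρ x : ℂ)) s := Complex.continuous_ofReal.continuousAt.comp
    (h.radius.hasDerivAt_deriv h.isOpen hs).continuousAt
  have hρ' : (ρ s : ℂ) ≠ 0 := by exact_mod_cast (h.pos s hs).ne'
  have factor : ∀ x, centreVelocity c u v x ^ 2 + ρ x ^ 2 * planeVelocity u v x ^ 2 = 0 →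
      ∀ ε : ℝ, ε = 1 ∨ ε = -1 →
      (centreVelocity c u v x - ε * Complex.I * ρ x * planeVelocity u v x)
        * (centreVelocity c u v x + ε * Complex.I * ρ x * planeVelocity u v x) = 0 := by
    rintro x hx ε hε
    have : (ε : ℂ) ^ 2 = 1 := by rcases hε with rfl | rfl <;> simp
    linear_combination hx + (ρ x ^ 2 * planeVelocity u v x ^ 2) * this
      - (ε ^ 2 * ρ x ^ 2 * planeVelocity u v x ^ 2) * Complex.I_sq
  obtain ⟨ε, hε, hεs⟩ : ∃ ε : ℝ, (ε = 1 ∨ ε = -1) ∧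
      centreVelocity c u v s = ε * Complex.I * ρ s * planeVelocity u v s := by
    rcases mul_eq_zero.1 (factor s hκ.self_of_nhds 1 (Or.inl rfl)) with h0 | h0
    · exact ⟨1, Or.inl rfl, by linear_combination h0⟩
    · exact ⟨-1, Or.inr rfl, by push_cast at h0 ⊢; linear_combination h0⟩
  have hε0 : (ε : ℂ) ≠ 0 := by rcases hε with rfl | rfl <;> simp
  -- The other factor of κ² + ρ²μ² equals 2εiρμ ≠ 0 at s, so it stays nonzero nearby and the same
  -- sign persists there.
  have hne : centreVelocity c u v s + ε * Complex.I * ρ s * planeVelocity u v s ≠ 0 := by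
    rw [hεs, ← two_mul]
    simp [hρ', hμ, hε0]
  have ev := ((cκ.add ((continuousAt_const.mul cρ).mul cμ)).eventually_ne hne).and
    ((cμ.eventually_ne hμ).and (hκ.and (h.isOpen.mem_nhds hs)))
  obtain ⟨U, hU, hUo, hsU⟩ := eventually_nhds_iff.1 ev
  have hUI : U ⊆ I := fun x hx => (hU x hx).2.2.2
  refine false_of_isotropic hJ (h.mono hUo hUI) (fun x hx => H x (hUI hx)) hsU
    (fun x hx => (hU x hx).2.1) hε fun x hx => ?_
  have := (mul_eq_zero.1 (factor x (hU x hx).2.2.1 ε hε)).resolve_right (hU x hx).1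
  linear_combination this

/-- The planes of the circles of a cyclic weighted minimal surface are parallel. -/
lemma deriv_planeNormal_eq_zero (hJ : IsOpenInterval J) (h : IsCircleFamily I c u v ρ)
    (H : ∀ s ∈ I, CircleVanishing J c u v ρ g s) (hs : s ∈ I) :
    deriv (planeNormal u v) s = 0 := by
  rw [h.deriv_planeNormal_eq_zero_iff hs]
  by_contra hμ
  obtain ⟨V, hV, hVo, hsV⟩ := eventually_nhds_iff.1
    (((h.continuousAt_planeVelocity hs).eventually_ne hμ).and (h.isOpen.mem_nhds hs))
  have hVI : V ⊆ I := fun x hx => (hV x hx).2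
  -- Where η ≠ 0, it remains nonzero on a neighbourhood, and degree 4 would make that whole
  -- neighbourhood isotropic.
  have hg : ∀ x ∈ V, ⟪g, u x⟫_ℝ = 0 ∧ ⟪g, v x⟫_ℝ = 0 := by
    intro x hx
    rw [← trigCoeff_eq_zero_iff]
    by_contra hη
    have cη : ContinuousAt (fun x => trigCoeff ⟪g, u x⟫_ℝ ⟪g, v x⟫_ℝ) x :=
      ContinuousAt.trigCoeff
        (continuousAt_const.inner (𝕜 := ℝ) (h.fst.hasDerivAt_deriv h.isOpen (hVI hx)).continuousAt)
        (continuousAt_const.inner (𝕜 := ℝ) (h.snd.hasDerivAt_deriv h.isOpen (hVI hx)).continuousAt)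
    refine false_of_eventually_isotropic hJ h H (hVI hx) (hV x hx).1 ?_
    filter_upwards [cη.eventually_ne hη, hVo.mem_nhds hx] with y hy hyV
    exact ((H y (hVI hyV)).eq_zero_or hJ (h.pos y (hVI hyV)) (hV y hyV).1).resolve_left hy
  have hg0 : g = 0 := by
    have hf := h.frame_uv hs
    have hr := h.relations_uv hs
    -- Now g is parallel to n on V while n turns at s; differentiating the orthogonality to u and v
    -- gives ⟪g, n⟫μ = 0.
    have d1 := (((hasDerivAt_const s g).inner ℝ (h.fst.hasDerivAt_deriv h.isOpen hs))).congr_on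
      (hasDerivAt_const s (0 : ℝ)) hVo hsV fun x hx => (hg x hx).1
    have d2 := (((hasDerivAt_const s g).inner ℝ (h.snd.hasDerivAt_deriv h.isOpen hs))).congr_on
      (hasDerivAt_const s (0 : ℝ)) hVo hsV fun x hx => (hg x hx).2
    rw [inner_zero_left, add_zero, hf.inner_eq, (hg s hsV).1, (hg s hsV).2, hr.e₁n] at d1
    rw [inner_zero_left, add_zero, hf.inner_eq, (hg s hsV).1, (hg s hsV).2, hr.f₁n] at d2
    have hn : ⟪g, planeNormal u v s⟫_ℝ = 0 := by
      by_contra hn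
      apply hμ
      rw [planeVelocity, trigCoeff_eq_zero_iff]
      simpa [hn] using And.intro d1 d2
    apply hf.ext <;> simp [hg s hsV, hn]
  subst hg0
  refine false_of_eventually_isotropic hJ h H hs hμ ?_
  filter_upwards [hVo.mem_nhds hsV] with y hy
  have hy' := H y (hVI hy)
  simp only [CircleVanishing, inner_zero_left] at hy'
  exact hy'.isotropic_of_density_eq_zero hJ (h.pos y (hVI hy)) (hV y hy).1

end IsCircleFamily

/-! ### Coaxial and coplanar families of circles -/

lemma IsOpenInterval.eq_of_deriv_eq_zero {E : Type*} [NormedAddCommGroup E] [NormedSpace ℝ E]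
    {I : Set ℝ} (hI : IsOpenInterval I) {f : ℝ → E}
    (hf : ∀ s ∈ I, HasDerivAt f 0 s) {s s' : ℝ} (hs : s ∈ I) (hs' : s' ∈ I) : f s = f s' :=
  hI.isOpen.is_const_of_deriv_eq_zero hI.ordConnected.isPreconnected
    (fun x hx => (hf x hx).differentiableAt.differentiableWithinAt)
    (fun x hx => (hf x hx).deriv) hs hs'

lemma continuous_axisRotation (p w x : E3) : Continuous fun θ => axisRotation p w θ x := by
  unfold axisRotation
  fun_prop

lemma axisRotation_zero (p w x : E3) : axisRotation p w 0 x = x := by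
  simp [axisRotation]

/-- A rotation about an axis orthogonal to a plane preserves that plane. -/
lemma inner_axisRotation_sub {p w : E3} (hw : ⟪w, w⟫_ℝ = 1) (θ : ℝ) (x : E3) :
    ⟪w, axisRotation p w θ x - p⟫_ℝ = ⟪w, x - p⟫_ℝ := by
  rw [axisRotation, add_sub_cancel_left]
  simp only [inner_add_right, real_inner_smul_right, inner_cross_self_left, hw]
  ring

lemma radial_add (u v : ℝ → E3) (s t θ : ℝ) :
    radial u v (t + θ) s = Real.cos θ • radial u v t s + Real.sin θ • tangential u v t s := by
  simp only [radial, tangential, Real.cos_add, Real.sin_add]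
  module

namespace IsCircleFamily

variable {I J : Set ℝ} {c u v : ℝ → E3} {ρ : ℝ → ℝ} {X : ℝ → ℝ → E3} {s t : ℝ} {n : E3}

/-- The centres stay on one line in the direction n. Rotation by θ about it sends the parameter t to
t + θ, which remains in the open set J for small θ. -/
lemma isRotational_of_coaxial (hI : IsOpenInterval I) (hJ : IsOpenInterval J)
    (h : IsCircleFamily I c u v ρ) (hX : IsSweptBy I J c u v ρ X)
    (hn : ∀ s ∈ I, planeNormal u v s = n)
    (hc : ∀ s ∈ I, deriv c s = ⟪deriv c s, n⟫_ℝ • n) : IsRotational I J X := by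
  obtain ⟨s₀, hs₀⟩ := hI.nonempty
  have hnn : ⟪n, n⟫_ℝ = 1 := by rw [← hn s₀ hs₀]; exact (h.frame_uv hs₀).nn
  have hconst : ∀ s ∈ I, c s - ⟪c s, n⟫_ℝ • n = c s₀ - ⟪c s₀, n⟫_ℝ • n := fun s hs => by
    refine hI.eq_of_deriv_eq_zero (f := fun x => c x - ⟪c x, n⟫_ℝ • n) (fun x hx => ?_) hs hs₀
    have dc := h.center.hasDerivAt_deriv h.isOpen hx
    refine (dc.sub ((dc.inner ℝ (hasDerivAt_const x n)).smul_const n)).congr_deriv ?_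
    rw [inner_zero_right, zero_add, ← hc x hx, sub_self]
  refine ⟨c s₀ - ⟪c s₀, n⟫_ℝ • n, n, ?_, ?_⟩
  · rw [real_inner_self_eq_norm_sq] at hnn
    exact (pow_eq_one_iff_of_nonneg (norm_nonneg _) two_ne_zero).1 hnn
  intro s hs t ht U hU
  have hcont : Filter.Tendsto (fun θ : ℝ => (s, t + θ)) (𝓝 0) (𝓝 (s, t)) := by
    have : Continuous fun θ : ℝ => (s, t + θ) := by fun_prop
    simpa using this.tendsto 0
  have hmem : U ∩ I ×ˢ J ∈ 𝓝 (s, t) :=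
    Filter.inter_mem hU (prod_mem_nhds (hI.isOpen.mem_nhds hs) (hJ.isOpen.mem_nhds ht))
  filter_upwards [hcont hmem] with θ hθ
  refine ⟨(s, t + θ), hθ, ?_⟩
  have hf := h.frame_rotate t hs
  rw [hn s hs] at hf
  rw [Function.uncurry_apply_pair, hX s hs _ hθ.2.2, hX s hs t ht, radial_add, ← hconst s hs,
    axisRotation]
  have e : c s + ρ s • radial u v t s - (c s - ⟪c s, n⟫_ℝ • n)
      = ⟪c s, n⟫_ℝ • n + ρ s • radial u v t s := by abel
  rw [e, cross_add_right, cross_smul_right, cross_smul_right, cross_self_eq_zero, hf.cross_ne,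
    inner_add_right, real_inner_smul_right, real_inner_smul_right, hf.nn, hf.ne]
  module

/-- The derivative of a surface swept out by circles, as a function of both parameters. -/
lemma exists_hasStrictFDerivAt (h : IsCircleFamily I c u v ρ) (hX : IsSweptBy I J c u v ρ X)
    (hJ : IsOpen J) (hs : s ∈ I) (ht : t ∈ J) :
    ∃ L : ℝ × ℝ →L[ℝ] E3, HasStrictFDerivAt (Function.uncurry X) L (s, t) ∧
      ∀ x, L x = x.1 • partialS X s t + x.2 • partialT X s t := by
  set Y : ℝ × ℝ → E3 :=
    fun q => c q.1 + ρ q.1 • (Real.cos q.2 • u q.1 + Real.sin q.2 • v q.1) with hY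
  have hXY : Function.uncurry X =ᶠ[𝓝 (s, t)] Y := by
    filter_upwards [prod_mem_nhds (h.isOpen.mem_nhds hs) (hJ.mem_nhds ht)] with q hq
    exact hX q.1 hq.1 q.2 hq.2
  have cd : ∀ {E : Type} [NormedAddCommGroup E] [NormedSpace ℝ E] {f : ℝ → E},
      ContDiffOn ℝ ∞ f I → ContDiffAt ℝ ∞ (fun q : ℝ × ℝ => f q.1) (s, t) := fun hf =>
    ContDiffAt.comp (s, t) (hf.contDiffAt (h.isOpen.mem_nhds hs)) contDiffAt_fst
  have hYd : ContDiffAt ℝ ∞ Y (s, t) :=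
    (cd h.center).add ((cd h.radius).smul (((Real.contDiff_cos.contDiffAt.comp (s, t)
      contDiffAt_snd).smul (cd h.fst)).add ((Real.contDiff_sin.contDiffAt.comp (s, t)
      contDiffAt_snd).smul (cd h.snd))))
  have hXd := (hYd.hasStrictFDerivAt (by simp)).congr_of_eventuallyEq hXY.symm
  refine ⟨_, hXd, fun x => ?_⟩
  have d1 : HasDerivAt (fun y : ℝ => (y, t)) ((1 : ℝ), (0 : ℝ)) s :=
    (hasDerivAt_id s).prodMk (hasDerivAt_const s t)
  have d2 : HasDerivAt (fun y : ℝ => (s, y)) ((0 : ℝ), (1 : ℝ)) t :=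
    (hasDerivAt_const t s).prodMk (hasDerivAt_id t)
  have e1 : partialS X s t = fderiv ℝ Y (s, t) (1, 0) :=
    (HasFDerivAt.comp_hasDerivAt (f := fun y : ℝ => (y, t)) s hXd.hasFDerivAt d1).deriv
  have e2 : partialT X s t = fderiv ℝ Y (s, t) (0, 1) :=
    (HasFDerivAt.comp_hasDerivAt (f := fun y : ℝ => (s, y)) t hXd.hasFDerivAt d2).deriv
  rw [e1, e2, ← map_smul, ← map_smul, ← map_add]
  simp

/-- An immersed surface in a plane is locally open in that plane, so any line normal to the plane
can be the axis; the one through `c s₀` is taken. -/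
lemma isRotational_of_coplanar (hI : IsOpenInterval I) (hJ : IsOpenInterval J)
    (h : IsCircleFamily I c u v ρ) (hX : IsSweptBy I J c u v ρ X)
    (hli : ∀ s ∈ I, ∀ t ∈ J, LinearIndependent ℝ ![partialS X s t, partialT X s t])
    (hn : ∀ s ∈ I, planeNormal u v s = n) (hc : ∀ s ∈ I, ⟪deriv c s, n⟫_ℝ = 0) :
    IsRotational I J X := by
  obtain ⟨s₀, hs₀⟩ := hI.nonempty
  have hf := h.frame_uv hs₀
  rw [hn s₀ hs₀] at hf
  set e₁ := u s₀
  set e₂ := v s₀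
  have hconst : ∀ s ∈ I, ⟪c s, n⟫_ℝ = ⟪c s₀, n⟫_ℝ := fun s hs => by
    refine hI.eq_of_deriv_eq_zero (f := fun x => ⟪c x, n⟫_ℝ) (fun x hx => ?_) hs hs₀
    have dc := h.center.hasDerivAt_deriv h.isOpen hx
    refine (dc.inner ℝ (hasDerivAt_const x n)).congr_deriv ?_
    rw [inner_zero_right, zero_add, hc x hx]
  have hplane : ∀ s ∈ I, ∀ t ∈ J, ⟪n, X s t - c s₀⟫_ℝ = 0 := fun s hs t ht => by
    have hf' := h.frame_rotate t hs
    rw [hn s hs] at hf'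
    rw [hX s hs t ht, inner_sub_right, inner_add_right, real_inner_smul_right, hf'.ne,
      real_inner_comm, hconst s hs, real_inner_comm]
    ring
  refine ⟨c s₀, n, ?_, ?_⟩
  · have hnn := hf.nn
    rw [real_inner_self_eq_norm_sq] at hnn
    exact (pow_eq_one_iff_of_nonneg (norm_nonneg _) two_ne_zero).1 hnn
  intro s hs t ht U hU
  obtain ⟨L, hL, hLx⟩ := h.exists_hasStrictFDerivAt hX hJ.isOpen hs ht
  set Q : E3 →L[ℝ] ℝ × ℝ := (innerSL ℝ e₁).prod (innerSL ℝ e₂) with hQ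
  have hQx : ∀ x, Q x = (⟪e₁, x⟫_ℝ, ⟪e₂, x⟫_ℝ) := fun x => rfl
  have hXs : ⟪partialS X s t, n⟫_ℝ = 0 := by
    have := h.inner_partialS_planeNormal hX hs ht
    rw [hn s hs, hc s hs] at this
    have hz : deriv (planeNormal u v) s = 0 := by
      have : planeNormal u v =ᶠ[𝓝 s] fun _ => n :=
        Filter.eventually_of_mem (hI.isOpen.mem_nhds hs) hn
      rw [this.deriv_eq, deriv_const]
    rw [this, hz]
    simp
  have hXt : ⟪partialT X s t, n⟫_ℝ = 0 := by
    have hf' := h.frame_rotate t hs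
    rw [hn s hs] at hf'
    rw [partialT_eq hX hJ.isOpen hs ht, real_inner_smul_left, hf'.fn, mul_zero]
  have hinj : Function.Injective (Q.comp L) := by
    rw [injective_iff_map_eq_zero]
    intro x hx
    rw [ContinuousLinearMap.comp_apply, hQx, Prod.mk_eq_zero] at hx
    have hLx0 : L x = 0 := by
      apply hf.ext
      · rw [real_inner_comm, hx.1, inner_zero_left]
      · rw [real_inner_comm, hx.2, inner_zero_left]
      · rw [hLx, inner_add_left, real_inner_smul_left, real_inner_smul_left, hXs, hXt]
        simp
    rw [hLx] at hLx0
    obtain ⟨h1, h2⟩ := LinearIndependent.pair_iff.1 (hli s hs t ht) _ _ hLx0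
    exact Prod.ext h1 h2
  have hsurj : Function.Surjective (Q.comp L) :=
    LinearMap.injective_iff_surjective (f := (Q.comp L : ℝ × ℝ →ₗ[ℝ] ℝ × ℝ)).1 hinj
  -- Planar coordinates turn X into a map between spaces of equal dimension with invertible
  -- derivative, which is therefore open at (s, t).
  have hmap := (Q.hasStrictFDerivAt.comp (s, t) hL).map_nhds_eq_of_surj
    (LinearMap.range_eq_top.2 hsurj)
  have hmem : U ∩ I ×ˢ J ∈ 𝓝 (s, t) :=
    Filter.inter_mem hU (prod_mem_nhds (hI.isOpen.mem_nhds hs) (hJ.isOpen.mem_nhds ht))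
  have himg : (fun q => Q (Function.uncurry X q)) '' (U ∩ I ×ˢ J) ∈ 𝓝 (Q (X s t)) := by
    have := Filter.image_mem_map (m := fun q => Q (Function.uncurry X q)) hmem
    exact hmap ▸ this
  have hcont : Filter.Tendsto (fun θ => Q (axisRotation (c s₀) n θ (X s t))) (𝓝 0)
      (𝓝 (Q (X s t))) := by
    have := (Q.continuous.comp (continuous_axisRotation (c s₀) n (X s t))).tendsto 0
    rwa [Function.comp_apply, axisRotation_zero] at this
  filter_upwards [hcont himg] with θ hθ
  obtain ⟨q, hq, hqθ⟩ := hθ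
  refine ⟨q, hq, ?_⟩
  simp only [hQx, Prod.mk.injEq] at hqθ
  apply hf.ext
  · rw [real_inner_comm, hqθ.1, real_inner_comm]
  · rw [real_inner_comm, hqθ.2, real_inner_comm]
  · have h1 := hplane q.1 hq.2.1 q.2 hq.2.2
    have h2 := inner_axisRotation_sub (p := c s₀) hf.nn θ (X s t)
    rw [hplane s hs t ht] at h2
    rw [inner_sub_right] at h1 h2
    rw [real_inner_comm, real_inner_comm n]
    exact (sub_left_inj.1 (h1.trans h2.symm))

end IsCircleFamily

/-! ### Circles in parallel planes -/

namespace IsCircleFamily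

variable {I J : Set ℝ} {c u v : ℝ → E3} {ρ : ℝ → ℝ} {X : ℝ → ℝ → E3} {s t : ℝ} {n g : E3}

lemma parallel_vanishes (h : IsCircleFamily I c u v ρ) (hn : ∀ s ∈ I, planeNormal u v s = n)
    (hs : s ∈ I) (H : CircleVanishing J c u v ρ g s) :
    VanishesOnCircle J (ρ s) (deriv ρ s) (deriv (deriv ρ) s) ⟪deriv c s, n⟫_ℝ
      ⟪deriv (deriv c) s, n⟫_ℝ ⟪g, n⟫_ℝ ⟪deriv c s, u s⟫_ℝ ⟪deriv c s, v s⟫_ℝ 0 0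
      ⟪deriv (deriv c) s, u s⟫_ℝ ⟪deriv (deriv c) s, v s⟫_ℝ 0 0 ⟪g, u s⟫_ℝ ⟪g, v s⟫_ℝ := by
  have h1 : planeNormal u v =ᶠ[𝓝 s] fun _ => n :=
    Filter.eventually_of_mem (h.isOpen.mem_nhds hs) hn
  have h2 : deriv (planeNormal u v) =ᶠ[𝓝 s] fun _ => 0 := by
    refine h1.deriv.trans ?_
    simp
  rw [CircleVanishing, h2.deriv_eq, h2.self_of_nhds, hn s hs] at H
  simpa using H

lemma deriv_center_eq_smul_iff (h : IsCircleFamily I c u v ρ)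
    (hn : ∀ s ∈ I, planeNormal u v s = n) (hs : s ∈ I) :
    deriv c s = ⟪deriv c s, n⟫_ℝ • n ↔ centreVelocity c u v s = 0 := by
  have hf := h.frame_uv hs
  rw [hn s hs] at hf
  rw [centreVelocity, trigCoeff_eq_zero_iff]
  constructor
  · intro h0
    rw [h0]
    simp [real_inner_smul_left, hf.ne, hf.nf]
  · rintro ⟨h1, h2⟩
    conv_lhs => rw [hf.expand (deriv c s), h1, h2]
    simp

/-- If κ ≠ 0, then g₃κ = hη shows that g₃ = 0 would give g = 0. So g₃ ≠ 0, the relation g₃ρ' = 0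
makes the radius locally constant, and the constant coefficient is contradictory. -/
lemma centreVelocity_eq_zero_of_density_ne_zero (hJ : IsOpenInterval J)
    (h : IsCircleFamily I c u v ρ) (hn : ∀ s ∈ I, planeNormal u v s = n)
    (H : ∀ s ∈ I, CircleVanishing J c u v ρ g s) (hg : g ≠ 0) (hs : s ∈ I)
    (hh : ⟪deriv c s, n⟫_ℝ ≠ 0) : centreVelocity c u v s = 0 := by
  by_contra hκ
  obtain ⟨V, hV, hVo, hsV⟩ := eventually_nhds_iff.1
    (((h.continuousAt_centreVelocity hs).eventually_ne hκ).and (h.isOpen.mem_nhds hs))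
  have key : ∀ x ∈ V, _ := fun x hx => (h.parallel_vanishes hn (hV x hx).2
    (H x (hV x hx).2)).parallel_density hJ (h.pos x (hV x hx).2) (hV x hx).1
  have hg3 : ⟪g, n⟫_ℝ ≠ 0 := by
    intro h3
    apply hg
    have h1 := (key s hsV).1
    rw [h3, Complex.ofReal_zero, zero_mul, eq_comm, mul_eq_zero] at h1
    have h2 := trigCoeff_eq_zero_iff.1 (h1.resolve_left (by exact_mod_cast hh))
    apply (h.frame_uv hs).ext
    · rw [h2.1, inner_zero_left]
    · rw [h2.2, inner_zero_left]
    · rw [hn s hs, h3, inner_zero_left]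
  have hρ1 : ∀ x ∈ V, deriv ρ x = 0 := fun x hx => (mul_eq_zero.1 (key x hx).2).resolve_left hg3
  have hρ2 : deriv (deriv ρ) s = 0 :=
    ((h.radius.contDiffOn_deriv h.isOpen).hasDerivAt_deriv h.isOpen hs).congr_on
      (hasDerivAt_const s (0 : ℝ)) hVo hsV hρ1
  have hs' := h.parallel_vanishes hn hs (H s hs)
  rw [hρ1 s hsV, hρ2] at hs'
  exact hs'.parallel_contradiction hJ hh

/-- Cyclic weighted minimal surfaces are rotational if the density is not constant. -/
lemma isRotational_of_density_ne_zero (hI : IsOpenInterval I) (hJ : IsOpenInterval J)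
    (h : IsCircleFamily I c u v ρ) (hX : IsSweptBy I J c u v ρ X)
    (hli : ∀ s ∈ I, ∀ t ∈ J, LinearIndependent ℝ ![partialS X s t, partialT X s t])
    (hn : ∀ s ∈ I, planeNormal u v s = n)
    (H : ∀ s ∈ I, CircleVanishing J c u v ρ g s) (hg : g ≠ 0) : IsRotational I J X := by
  by_cases hpl : ∀ s ∈ I, ⟪deriv c s, n⟫_ℝ = 0
  · exact h.isRotational_of_coplanar hI hJ hX hli hn hpl
  push Not at hpl
  obtain ⟨s₁, hs₁, hh₁⟩ := hpl
  have dc := (h.center.contDiffOn_deriv h.isOpen).hasDerivAt_deriv h.isOpen hs₁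
  obtain ⟨V, hV, hVo, hsV⟩ := eventually_nhds_iff.1
    (((dc.continuousAt.inner (𝕜 := ℝ) continuousAt_const).eventually_ne hh₁).and
      (h.isOpen.mem_nhds hs₁))
  have hcV : ∀ x ∈ V, deriv c x = ⟪deriv c x, n⟫_ℝ • n := fun x hx =>
    (h.deriv_center_eq_smul_iff hn (hV x hx).2).2
      (centreVelocity_eq_zero_of_density_ne_zero hJ h hn H hg (hV x hx).2 (hV x hx).1)
  have hf := h.frame_uv hs₁
  rw [hn s₁ hs₁] at hf
  have orth : ∀ e, ⟪n, e⟫_ℝ = 0 → ⟪deriv c s₁, e⟫_ℝ = 0 ∧ ⟪deriv (deriv c) s₁, e⟫_ℝ = 0 := by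
    intro e he
    have h0 : ∀ x ∈ V, ⟪deriv c x, e⟫_ℝ = 0 := fun x hx => by
      rw [hcV x hx, real_inner_smul_left, he, mul_zero]
    have := inner_deriv_add_of_const dc (hasDerivAt_const s₁ e) hVo hsV h0
    rw [inner_zero_right, zero_add] at this
    exact ⟨h0 s₁ hsV, this⟩
  have hg12 : ⟪g, u s₁⟫_ℝ = 0 ∧ ⟪g, v s₁⟫_ℝ = 0 := by
    have hs' := h.parallel_vanishes hn hs₁ (H s₁ hs₁)
    rw [(orth _ hf.ne).1, (orth _ hf.ne).2, (orth _ hf.nf).1, (orth _ hf.nf).2] at hs'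
    exact hs'.parallel_coaxial hJ (h.pos s₁ hs₁) hh₁
  have hg3 : ⟪g, n⟫_ℝ ≠ 0 := fun h3 => hg (hf.ext (by rw [hg12.1, inner_zero_left])
    (by rw [hg12.2, inner_zero_left]) (by rw [h3, inner_zero_left]))
  refine h.isRotational_of_coaxial hI hJ hX hn fun s hs => ?_
  rw [h.deriv_center_eq_smul_iff hn hs]
  -- The crossing at s₁ has shown that g is normal to the planes. At a parameter with h = 0, degree
  -- 3 therefore still forces κ = 0.
  by_cases hh : ⟪deriv c s, n⟫_ℝ = 0
  · by_contra hκ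
    have hs' := h.parallel_vanishes hn hs (H s hs)
    rw [hh] at hs'
    exact hg3 (hs'.parallel_planar hJ (h.pos s hs) hκ)
  · exact centreVelocity_eq_zero_of_density_ne_zero hJ h hn H hg hs hh

/-! ### Minimal surfaces foliated by circles in parallel planes -/

lemma parallel_minimal (hJ : IsOpenInterval J)
    (h : IsCircleFamily I c u v ρ) (hn : ∀ s ∈ I, planeNormal u v s = n) (hs : s ∈ I)
    (H : CircleVanishing J c u v ρ 0 s) :
    (∀ e, ⟪n, e⟫_ℝ = 0 → ρ s * (⟪deriv (deriv c) s, n⟫_ℝ * ⟪deriv c s, e⟫_ℝ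
      - ⟪deriv c s, n⟫_ℝ * ⟪deriv (deriv c) s, e⟫_ℝ)
      + 2 * deriv ρ s * ⟪deriv c s, n⟫_ℝ * ⟪deriv c s, e⟫_ℝ = 0) ∧
    (deriv ρ s ^ 2 + ⟪deriv c s, deriv c s⟫_ℝ) * ⟪deriv c s, n⟫_ℝ
      + ρ s * (deriv ρ s * ⟪deriv (deriv c) s, n⟫_ℝ - ⟪deriv c s, n⟫_ℝ * deriv (deriv ρ) s) = 0 := by
  have hs' := h.parallel_vanishes hn hs H
  simp only [inner_zero_left] at hs'
  obtain ⟨h1, h2, h3⟩ := hs'.parallel_minimal hJ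
  have hf := h.frame_uv hs
  rw [hn s hs] at hf
  refine ⟨fun e he => ?_, ?_⟩
  · rw [hf.inner_eq (deriv c s) e, hf.inner_eq (deriv (deriv c) s) e, real_inner_comm n e, he]
    linear_combination ⟪e, u s⟫_ℝ * h1 + ⟪e, v s⟫_ℝ * h2
  · rw [hf.inner_eq (deriv c s) (deriv c s)]
    linear_combination h3

end IsCircleFamily

/-- A Grönwall estimate, with k bounded near s, on the right of s; reflection gives the left. -/
lemma eventually_eq_zero_of_deriv_eq_mul {f k : ℝ → ℝ} {s : ℝ}
    (hf : ∀ᶠ x in 𝓝 s, HasDerivAt f (k x * f x) x) (hk : ContinuousAt k s) (h0 : f s = 0) :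
    ∀ᶠ x in 𝓝 s, f x = 0 := by
  have hb : ∀ᶠ x in 𝓝 s, ‖k x‖ < ‖k s‖ + 1 :=
    hk.norm.eventually_lt continuousAt_const (lt_add_one _)
  obtain ⟨δ, hδ, hball⟩ := Metric.eventually_nhds_iff_ball.1 (hf.and hb)
  have right : ∀ (F K : ℝ → ℝ), F 0 = 0 →
      (∀ x, |x| < δ → HasDerivAt F (K x * F x) x ∧ ‖K x‖ < ‖k s‖ + 1) →
      ∀ x, 0 ≤ x → x < δ → F x = 0 := by
    intro F K hF0 hFK x hx0 hxδ
    refine eq_zero_of_abs_deriv_le_mul_abs_self_of_eq_zero_right (f := F) (f' := fun y => K y * F y)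
      (K := ‖k s‖ + 1) (a := 0) (b := x) ?_ ?_ hF0 ?_ x ⟨hx0, le_rfl⟩
    · intro y hy
      have := hFK y (by rw [abs_of_nonneg hy.1]; linarith [hy.2])
      exact this.1.continuousAt.continuousWithinAt
    · intro y hy
      have := hFK y (by rw [abs_of_nonneg hy.1]; linarith [hy.2])
      exact this.1.hasDerivWithinAt
    · intro y hy
      have := hFK y (by rw [abs_of_nonneg hy.1]; linarith [hy.2])
      rw [norm_mul]
      exact mul_le_mul_of_nonneg_right this.2.le (norm_nonneg _)
  refine Metric.eventually_nhds_iff_ball.2 ⟨δ, hδ, fun x hx => ?_⟩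
  rw [Metric.mem_ball, Real.dist_eq] at hx
  have hball' : ∀ y, |y - s| < δ → _ := fun y hy => hball y (by rwa [Metric.mem_ball, Real.dist_eq])
  rcases le_total s x with hsx | hsx
  · have := right (fun y => f (s + y)) (fun y => k (s + y)) (by simpa using h0) (fun y hy => by
      have := hball' (s + y) (by simpa using hy)
      exact ⟨this.1.comp_const_add s y, this.2⟩) (x - s) (by linarith) (by
        rwa [abs_of_nonneg (by linarith)] at hx)
    simpa using this
  · have := right (fun y => f (s - y)) (fun y => -k (s - y)) (by simpa using h0) (fun y hy => by
      have := hball' (s - y) (by simpa using hy)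
      refine ⟨(this.1.comp_const_sub s y).congr_deriv (by ring), by simpa using this.2⟩) (s - x)
        (by linarith) (by
        rw [abs_of_nonpos (by linarith)] at hx; linarith)
    simpa using this

namespace IsCircleFamily

variable {I J : Set ℝ} {c u v : ℝ → E3} {ρ : ℝ → ℝ} {X : ℝ → ℝ → E3} {s t : ℝ} {n g : E3}

/-- If the plane of one circle is not crossed, then no plane is crossed. -/
lemma inner_deriv_center_eq_zero (hI : IsOpenInterval I) (hJ : IsOpenInterval J)
    (h : IsCircleFamily I c u v ρ) (hX : IsSweptBy I J c u v ρ X)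
    (hli : ∀ s ∈ I, ∀ t ∈ J, LinearIndependent ℝ ![partialS X s t, partialT X s t])
    (hn : ∀ s ∈ I, planeNormal u v s = n)
    (H : ∀ s ∈ I, CircleVanishing J c u v ρ 0 s) {s₀ : ℝ} (hs₀ : s₀ ∈ I)
    (h0 : ⟪deriv c s₀, n⟫_ℝ = 0) : ∀ s ∈ I, ⟪deriv c s, n⟫_ℝ = 0 := by
  have dc : ∀ s ∈ I, HasDerivAt (deriv c) (deriv (deriv c) s) s := fun s hs =>
    (h.center.contDiffOn_deriv h.isOpen).hasDerivAt_deriv h.isOpen hs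
  have dρ : ∀ s ∈ I, HasDerivAt (deriv ρ) (deriv (deriv ρ) s) s := fun s hs =>
    (h.radius.contDiffOn_deriv h.isOpen).hasDerivAt_deriv h.isOpen hs
  have dh : ∀ s ∈ I, HasDerivAt (fun x => ⟪deriv c x, n⟫_ℝ) ⟪deriv (deriv c) s, n⟫_ℝ s :=
    fun s hs => ((dc s hs).inner ℝ (hasDerivAt_const s n)).congr_deriv (by simp)
  have ev : ∀ s ∈ I, ⟪deriv c s, n⟫_ℝ = 0 → ∀ᶠ x in 𝓝 s, ⟪deriv c x, n⟫_ℝ = 0 := by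
    intro s hs hz
    set e₁ := u s
    set e₂ := v s
    have hf : IsFrame e₁ e₂ n := by have := h.frame_uv hs; rwa [hn s hs] at this
    -- Multiply the two degree 1 equations by the planar components of c' and the degree 0 equation
    -- by ρ', and add: the result is D h' = F h. Where h = 0, immersion makes D nonzero.
    set D : ℝ → ℝ := fun x => ρ x * (deriv ρ x ^ 2 + ⟪deriv c x, e₁⟫_ℝ ^ 2
      + ⟪deriv c x, e₂⟫_ℝ ^ 2) with hD
    set F : ℝ → ℝ := fun x => ρ x * (⟪deriv (deriv c) x, e₁⟫_ℝ * ⟪deriv c x, e₁⟫_ℝ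
      + ⟪deriv (deriv c) x, e₂⟫_ℝ * ⟪deriv c x, e₂⟫_ℝ)
      - 2 * deriv ρ x * (⟪deriv c x, e₁⟫_ℝ ^ 2 + ⟪deriv c x, e₂⟫_ℝ ^ 2)
      + deriv ρ x * (ρ x * deriv (deriv ρ) x - (deriv ρ x ^ 2 + ⟪deriv c x, deriv c x⟫_ℝ)) with hF
    have c1 := (dc s hs).continuousAt
    have c2 := (((h.center.contDiffOn_deriv h.isOpen).contDiffOn_deriv h.isOpen).hasDerivAt_deriv
      h.isOpen hs).continuousAt
    have r0 := (h.radius.hasDerivAt_deriv h.isOpen hs).continuousAt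
    have r1 := (dρ s hs).continuousAt
    have r2 := (((h.radius.contDiffOn_deriv h.isOpen).contDiffOn_deriv h.isOpen).hasDerivAt_deriv
      h.isOpen hs).continuousAt
    have cD : ContinuousAt D s := by fun_prop
    have cF : ContinuousAt F s := by fun_prop
    have hDs : D s ≠ 0 := by
      obtain ⟨t, ht⟩ := hJ.nonempty
      have h1 := (h.linearIndependent_iff hX hJ.isOpen hs ht).1 (hli s hs t ht)
      intro hDs
      apply h1
      have hD0 := (mul_eq_zero.1 hDs).resolve_left (h.pos s hs).ne'
      have z0 : deriv ρ s = 0 := by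
        apply pow_eq_zero_iff two_ne_zero |>.1
        nlinarith [sq_nonneg (deriv ρ s), sq_nonneg ⟪deriv c s, e₁⟫_ℝ, sq_nonneg ⟪deriv c s, e₂⟫_ℝ]
      have z1 : ⟪deriv c s, e₁⟫_ℝ = 0 := by
        apply pow_eq_zero_iff two_ne_zero |>.1
        nlinarith [sq_nonneg (deriv ρ s), sq_nonneg ⟪deriv c s, e₁⟫_ℝ, sq_nonneg ⟪deriv c s, e₂⟫_ℝ]
      have z2 : ⟪deriv c s, e₂⟫_ℝ = 0 := by
        apply pow_eq_zero_iff two_ne_zero |>.1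
        nlinarith [sq_nonneg (deriv ρ s), sq_nonneg ⟪deriv c s, e₁⟫_ℝ, sq_nonneg ⟪deriv c s, e₂⟫_ℝ]
      have hcz : deriv c s = 0 := hf.ext (by rw [z1, inner_zero_left]) (by rw [z2, inner_zero_left])
        (by rw [hz, inner_zero_left])
      have hnz : deriv (planeNormal u v) s = 0 := by
        have : planeNormal u v =ᶠ[𝓝 s] fun _ => n :=
          Filter.eventually_of_mem (hI.isOpen.mem_nhds hs) hn
        rw [this.deriv_eq, deriv_const]
      rw [h.inner_partialS_radial hX hs ht, h.inner_partialS_planeNormal hX hs ht, z0, hcz, hnz]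
      simp
    refine eventually_eq_zero_of_deriv_eq_mul (k := fun x => F x / D x) ?_ (cF.div cD hDs) hz
    filter_upwards [cD.eventually_ne hDs, h.isOpen.mem_nhds hs] with x hx hxI
    refine (dh x hxI).congr_deriv ?_
    obtain ⟨m1, m2⟩ := h.parallel_minimal hJ hn hxI (H x hxI)
    rw [div_mul_eq_mul_div, eq_div_iff hx]
    linear_combination ⟪deriv c x, e₁⟫_ℝ * m1 e₁ hf.ne + ⟪deriv c x, e₂⟫_ℝ * m1 e₂ hf.nf
      + deriv ρ x * m2
  -- The zeros of h and its nonzeros are both open in the connected set I.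
  set Z : Set ℝ := {s | ∀ᶠ x in 𝓝 s, x ∈ I ∧ ⟪deriv c x, n⟫_ℝ = 0} with hZ
  set W : Set ℝ := {s | ∀ᶠ x in 𝓝 s, x ∈ I ∧ ⟪deriv c x, n⟫_ℝ ≠ 0} with hW
  have hdisj : Disjoint Z W := Set.disjoint_left.2 fun x hxZ hxW =>
    hxW.self_of_nhds.2 hxZ.self_of_nhds.2
  have hcover : I ⊆ Z ∪ W := fun x hx => by
    by_cases hxz : ⟪deriv c x, n⟫_ℝ = 0
    · exact Or.inl ((h.isOpen.eventually_mem hx).and (ev x hx hxz))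
    · exact Or.inr ((h.isOpen.eventually_mem hx).and ((dh x hx).continuousAt.eventually_ne hxz))
  have hsub := hI.ordConnected.isPreconnected.subset_left_of_subset_union
    isOpen_setOfPred_eventually_nhds isOpen_setOfPred_eventually_nhds hdisj hcover
    ⟨s₀, hs₀, (h.isOpen.eventually_mem hs₀).and (ev s₀ hs₀ h0)⟩
  exact fun s hs => (hsub hs).self_of_nhds.2

/-- The velocity of the centres of the circles of a minimal surface, in a fixed horizontal
direction, is proportional to the vertical velocity times the square of the radius. -/
lemma exists_inner_deriv_center_eq (hI : IsOpenInterval I) (hJ : IsOpenInterval J)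
    (h : IsCircleFamily I c u v ρ) (hn : ∀ s ∈ I, planeNormal u v s = n)
    (H : ∀ s ∈ I, CircleVanishing J c u v ρ 0 s) (hh : ∀ s ∈ I, ⟪deriv c s, n⟫_ℝ ≠ 0)
    {e : E3} (he : ⟪n, e⟫_ℝ = 0) :
    ∃ l : ℝ, ∀ s ∈ I, ⟪deriv c s, e⟫_ℝ = l * (⟪deriv c s, n⟫_ℝ * ρ s ^ 2) := by
  obtain ⟨s₀, hs₀⟩ := hI.nonempty
  have hne : ∀ s ∈ I, ⟪deriv c s, n⟫_ℝ * ρ s ^ 2 ≠ 0 := fun s hs =>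
    mul_ne_zero (hh s hs) (pow_ne_zero 2 (h.pos s hs).ne')
  refine ⟨⟪deriv c s₀, e⟫_ℝ / (⟪deriv c s₀, n⟫_ℝ * ρ s₀ ^ 2), fun s hs => ?_⟩
  rw [← div_eq_iff (hne s hs)]
  refine hI.eq_of_deriv_eq_zero (f := fun x => ⟪deriv c x, e⟫_ℝ / (⟪deriv c x, n⟫_ℝ * ρ x ^ 2))
    (fun x hx => ?_) hs hs₀
  have dc := (h.center.contDiffOn_deriv h.isOpen).hasDerivAt_deriv h.isOpen hx
  have dρ := h.radius.hasDerivAt_deriv h.isOpen hx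
  refine ((dc.inner ℝ (hasDerivAt_const x e)).div ((dc.inner ℝ (hasDerivAt_const x n)).mul
    (dρ.pow 2)) (hne x hx)).congr_deriv ?_
  rw [div_eq_zero_iff]
  left
  simp only [inner_zero_right, zero_add, Pi.mul_apply, Pi.pow_apply]
  have := (h.parallel_minimal hJ hn hx (H x hx)).1 e he
  push_cast
  linear_combination -ρ x * this

end IsCircleFamily

/-! ### Parametrization by height -/

/-- Rolle's theorem gives injectivity, and the inverse function theorem gives openness of the image
and the derivative. -/
lemma IsOpenInterval.exists_inverse {I : Set ℝ} (hI : IsOpenInterval I) {f : ℝ → ℝ}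
    (hf : ContDiffOn ℝ ∞ f I) (hf' : ∀ s ∈ I, deriv f s ≠ 0) :
    ∃ σ : ℝ → ℝ, IsOpenInterval (f '' I) ∧ (∀ s ∈ I, σ (f s) = s) ∧
      ∀ s ∈ I, HasDerivAt σ (deriv f s)⁻¹ (f s) := by
  have hd : ∀ s ∈ I, HasDerivAt f (deriv f s) s := fun s hs => hf.hasDerivAt_deriv hI.isOpen hs
  have hsd : ∀ s ∈ I, HasStrictDerivAt f (deriv f s) s := fun s hs =>
    (hf.contDiffAt (hI.isOpen.mem_nhds hs)).hasStrictDerivAt (by simp)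
  have lt_ne : ∀ a ∈ I, ∀ b ∈ I, a < b → f a ≠ f b := by
    intro a ha b hb hab heq
    have hsub : Set.Icc a b ⊆ I := hI.ordConnected.out ha hb
    obtain ⟨x, hx, hx0⟩ := exists_hasDerivAt_eq_zero hab
      (fun y hy => (hd y (hsub hy)).continuousAt.continuousWithinAt) heq
      (fun y hy => hd y (hsub (Set.Ioo_subset_Icc_self hy)))
    exact hf' x (hsub (Set.Ioo_subset_Icc_self hx)) hx0
  have hinj : Set.InjOn f I := by
    intro a ha b hb heq
    by_contra hne
    rcases lt_or_gt_of_ne hne with h | h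
    · exact lt_ne a ha b hb h heq
    · exact lt_ne b hb a ha h heq.symm
  have hσ : ∀ s ∈ I, Function.invFunOn f I (f s) = s := fun s hs => hinj.leftInvOn_invFunOn hs
  refine ⟨Function.invFunOn f I, ⟨?_, ?_, hI.nonempty.image f⟩, hσ, ?_⟩
  · rw [isOpen_iff_mem_nhds]
    rintro _ ⟨s, hs, rfl⟩
    rw [← (hsd s hs).map_nhds_eq (hf' s hs)]
    exact Filter.image_mem_map (hI.isOpen.mem_nhds hs)
  · exact (hI.ordConnected.isPreconnected.image f
      fun s hs => (hd s hs).continuousAt.continuousWithinAt).ordConnected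
  · intro s hs
    exact ((hsd s hs).to_local_left_inverse (hf' s hs)
      (Filter.eventually_of_mem (hI.isOpen.mem_nhds hs) hσ)).hasDerivAt

namespace IsCircleFamily

variable {I J : Set ℝ} {c u v : ℝ → E3} {ρ : ℝ → ℝ} {X : ℝ → ℝ → E3} {n : E3}

lemma isRiemannExample_of_frame (hI : IsOpenInterval I) (hJ : IsOpenInterval J)
    (h : IsCircleFamily I c u v ρ) (hX : IsSweptBy I J c u v ρ X)
    (hn : ∀ s ∈ I, planeNormal u v s = n)
    (H : ∀ s ∈ I, CircleVanishing J c u v ρ 0 s) (hh : ∀ s ∈ I, ⟪deriv c s, n⟫_ℝ ≠ 0)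
    {e₁ e₂ : E3} (hf : IsFrame e₁ e₂ n) {l : ℝ} (hl : 0 < l)
    (h1 : ∀ s ∈ I, ⟪deriv c s, e₁⟫_ℝ = l * (⟪deriv c s, n⟫_ℝ * ρ s ^ 2))
    (h2 : ∀ s ∈ I, ⟪deriv c s, e₂⟫_ℝ = 0) : IsRiemannExample I J X := by
  obtain ⟨s₀, hs₀⟩ := hI.nonempty
  have dc : ∀ s ∈ I, HasDerivAt c (deriv c s) s := fun s hs => h.center.hasDerivAt_deriv h.isOpen hs
  have dcoord : ∀ e : E3, ∀ s ∈ I, HasDerivAt (fun x => ⟪c x - c s₀, e⟫_ℝ) ⟪deriv c s, e⟫_ℝ s :=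
    fun e s hs => (((dc s hs).sub_const (c s₀)).inner ℝ (hasDerivAt_const s e)).congr_deriv (by simp)
  have dc₂ : ∀ s ∈ I, HasDerivAt (fun x => ⟪deriv c x, n⟫_ℝ) ⟪deriv (deriv c) s, n⟫_ℝ s :=
    fun s hs => (((h.center.contDiffOn_deriv h.isOpen).hasDerivAt_deriv h.isOpen hs).inner ℝ
      (hasDerivAt_const s n)).congr_deriv (by simp)
  have dρ : ∀ s ∈ I, HasDerivAt ρ (deriv ρ s) s := fun s hs =>
    h.radius.hasDerivAt_deriv h.isOpen hs
  have dρ₂ : ∀ s ∈ I, HasDerivAt (deriv ρ) (deriv (deriv ρ) s) s := fun s hs =>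
    (h.radius.contDiffOn_deriv h.isOpen).hasDerivAt_deriv h.isOpen hs
  set ζ : ℝ → ℝ := fun x => ⟪c x - c s₀, n⟫_ℝ with hζ
  have hζd : ∀ s ∈ I, deriv ζ s = ⟪deriv c s, n⟫_ℝ := fun s hs => (dcoord n s hs).deriv
  obtain ⟨σ, hK, hσ, dσ⟩ := hI.exists_inverse (f := ζ)
    ((h.center.sub contDiffOn_const).inner ℝ contDiffOn_const)
    (fun s hs => by rw [hζd s hs]; exact hh s hs)
  have comp : ∀ (F : ℝ → ℝ) (F' : ℝ), ∀ s ∈ I, HasDerivAt F F' s →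
      HasDerivAt (fun z => F (σ z)) (F' * (⟪deriv c s, n⟫_ℝ)⁻¹) (ζ s) := by
    intro F F' s hs hF
    rw [← hζd s hs]
    exact HasDerivAt.comp (ζ s) (by rwa [hσ s hs]) (dσ s hs)
  -- the differential equation of the radius
  have ode : ∀ s ∈ I, ρ s * (deriv (deriv ρ) s * ⟪deriv c s, n⟫_ℝ
      - deriv ρ s * ⟪deriv (deriv c) s, n⟫_ℝ) = (deriv ρ s ^ 2 + ⟪deriv c s, n⟫_ℝ ^ 2
        + l ^ 2 * ⟪deriv c s, n⟫_ℝ ^ 2 * ρ s ^ 4) * ⟪deriv c s, n⟫_ℝ := by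
    intro s hs
    have m2 := (h.parallel_minimal hJ hn hs (H s hs)).2
    rw [hf.inner_eq (deriv c s) (deriv c s), h1 s hs, h2 s hs] at m2
    linear_combination -m2
  -- q is the derivative of the radius with respect to height; in that variable `ode` reads r r'' =
  -- r'² + 1 + l² r⁴.
  set q : ℝ → ℝ := fun x => deriv ρ x / ⟪deriv c x, n⟫_ℝ with hq
  have dq : ∀ s ∈ I, HasDerivAt q
      (⟪deriv c s, n⟫_ℝ * (q s ^ 2 + 1 + l ^ 2 * ρ s ^ 4) / ρ s) s := by
    intro s hs
    refine ((dρ₂ s hs).div (dc₂ s hs) (hh s hs)).congr_deriv ?_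
    have e1 := ode s hs
    have e2 := hh s hs
    have e3 := (h.pos s hs).ne'
    simp only [hq]
    field_simp
    linear_combination e1
  have hqρ : ∀ s ∈ I, deriv ρ s = ⟪deriv c s, n⟫_ℝ * q s := fun s hs => by
    rw [hq, mul_div_cancel₀ _ (hh s hs)]
  -- This first integral is Riemann's constant C.
  have first : ∀ s ∈ I, (q s ^ 2 + 1 - l ^ 2 * ρ s ^ 4) / ρ s ^ 2
      = (q s₀ ^ 2 + 1 - l ^ 2 * ρ s₀ ^ 4) / ρ s₀ ^ 2 := by
    intro s hs
    refine hI.eq_of_deriv_eq_zero (f := fun x => (q x ^ 2 + 1 - l ^ 2 * ρ x ^ 4) / ρ x ^ 2)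
      (fun x hx => ?_) hs hs₀
    have e3 := (h.pos x hx).ne'
    have num : HasDerivAt (fun y => q y ^ 2 + 1 - l ^ 2 * ρ y ^ 4) _ x :=
      (((dq x hx).pow 2).add_const 1).sub (((dρ x hx).pow 4).const_mul (l ^ 2))
    refine (num.div ((dρ x hx).pow 2) (pow_ne_zero 2 e3)).congr_deriv ?_
    rw [hqρ x hx]
    simp only [Pi.pow_apply]
    field_simp
    push_cast
    ring
  set C := (q s₀ ^ 2 + 1 - l ^ 2 * ρ s₀ ^ 4) / ρ s₀ ^ 2 with hC
  have energy : ∀ s ∈ I, q s ^ 2 = l ^ 2 * ρ s ^ 4 + C * ρ s ^ 2 - 1 := by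
    intro s hs
    have := first s hs
    rw [div_eq_iff (pow_ne_zero 2 (h.pos s hs).ne')] at this
    linear_combination this
  have hy : ∀ s ∈ I, ⟪c s - c s₀, e₂⟫_ℝ = 0 := fun s hs => by
    rw [hI.eq_of_deriv_eq_zero (f := fun x => ⟪c x - c s₀, e₂⟫_ℝ)
      (fun x hx => (dcoord e₂ x hx).congr_deriv (h2 x hx)) hs hs₀]
    simp
  refine ⟨{x : E3 | x 2 ∈ ζ '' I ∧
      (x 0 - ⟪c (σ (x 2)) - c s₀, e₁⟫_ℝ) ^ 2 + x 1 ^ 2 = ρ (σ (x 2)) ^ 2},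
    (IsometryEquiv.subRight (c s₀)).trans hf.basis.repr.toIsometryEquiv,
    ⟨l, C, ζ '' I, fun z => ⟪c (σ z) - c s₀, e₁⟫_ℝ, fun z => ρ (σ z), fun z => q (σ z), hl, hK,
      ?_, rfl⟩, ?_⟩
  · rintro _ ⟨s, hs, rfl⟩
    have e2 := hh s hs
    have e3 := (h.pos s hs).ne'
    simp only [hσ s hs]
    refine ⟨h.pos s hs, ?_, ?_, ?_, energy s hs⟩
    · refine (comp _ _ s hs (dcoord e₁ s hs)).congr_deriv ?_
      rw [h1 s hs]
      field_simp
    · exact comp _ _ s hs (dρ s hs)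
    · refine (comp _ _ s hs (dq s hs)).congr_deriv ?_
      have := energy s hs
      rw [this]
      field_simp
      ring
  · intro s hs t ht
    have hcoord : ∀ i, ((IsometryEquiv.subRight (c s₀)).trans hf.basis.repr.toIsometryEquiv) (X s t) i
        = ⟪X s t - c s₀, ![e₁, e₂, n] i⟫_ℝ := fun i => by
      rw [real_inner_comm, ← hf.basis_apply, ← hf.basis.repr_apply_apply]
      rfl
    have hXs : X s t - c s₀ = (c s - c s₀) + ρ s • radial u v t s := by rw [hX s hs t ht]; abel
    have hf' := h.frame_rotate t hs
    rw [hn s hs] at hf'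
    have hz : ((IsometryEquiv.subRight (c s₀)).trans hf.basis.repr.toIsometryEquiv) (X s t) 2
        = ζ s := by
      rw [hcoord, hXs, inner_add_left, real_inner_smul_left]
      simp [hζ, hf'.en]
    refine ⟨by rw [hz]; exact ⟨s, hs, rfl⟩, ?_⟩
    rw [hz, hσ s hs, hcoord, hcoord, hXs]
    simp only [Matrix.cons_val_zero, Matrix.cons_val_one, inner_add_left, real_inner_smul_left,
      hy s hs]
    have := hf.inner_eq (radial u v t s) (radial u v t s)
    rw [hf'.ee, hf'.en] at this
    linear_combination -ρ s ^ 2 * this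

/-- A minimal surface swept out by circles is rotational or one of Riemann's examples. -/
lemma isRotational_or_isRiemannExample (hI : IsOpenInterval I) (hJ : IsOpenInterval J)
    (h : IsCircleFamily I c u v ρ) (hX : IsSweptBy I J c u v ρ X)
    (hli : ∀ s ∈ I, ∀ t ∈ J, LinearIndependent ℝ ![partialS X s t, partialT X s t])
    (hn : ∀ s ∈ I, planeNormal u v s = n)
    (H : ∀ s ∈ I, CircleVanishing J c u v ρ 0 s) :
    IsRotational I J X ∨ IsRiemannExample I J X := by
  by_cases hh : ∀ s ∈ I, ⟪deriv c s, n⟫_ℝ ≠ 0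
  swap
  · push Not at hh
    obtain ⟨s, hs, hs0⟩ := hh
    exact Or.inl (h.isRotational_of_coplanar hI hJ hX hli hn
      (h.inner_deriv_center_eq_zero hI hJ hX hli hn H hs hs0))
  obtain ⟨s₀, hs₀⟩ := hI.nonempty
  have hf := h.frame_uv hs₀
  rw [hn s₀ hs₀] at hf
  obtain ⟨l₁, hl₁⟩ := h.exists_inner_deriv_center_eq hI hJ hn H hh hf.ne
  obtain ⟨l₂, hl₂⟩ := h.exists_inner_deriv_center_eq hI hJ hn H hh hf.nf
  -- Rotating the horizontal frame by arg w aligns the drift of the centres with the first axis, and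
  -- ‖w‖ becomes the constant λ.
  set w : ℂ := ⟨l₁, l₂⟩ with hw
  by_cases hw0 : w = 0
  · left
    have h12 : l₁ = 0 ∧ l₂ = 0 := by simpa [hw, Complex.ext_iff] using hw0
    refine h.isRotational_of_coaxial hI hJ hX hn fun s hs => ?_
    conv_lhs => rw [hf.expand (deriv c s), hl₁ s hs, hl₂ s hs, h12.1, h12.2]
    simp
  · right
    have hc : l₁ = ‖w‖ * Real.cos w.arg := (Complex.norm_mul_cos_arg w).symm
    have hs : l₂ = ‖w‖ * Real.sin w.arg := (Complex.norm_mul_sin_arg w).symm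
    have hcs := Real.sin_sq_add_cos_sq w.arg
    refine h.isRiemannExample_of_frame hI hJ hX hn H hh (hf.rotate w.arg) (norm_pos_iff.2 hw0)
      (fun s hs' => ?_) (fun s hs' => ?_)
    · rw [inner_add_right, real_inner_smul_right, real_inner_smul_right, hl₁ s hs', hl₂ s hs', hc,
        hs]
      linear_combination ‖w‖ * (⟪deriv c s, n⟫_ℝ * ρ s ^ 2) * hcs
    · rw [inner_add_right, real_inner_smul_right, real_inner_smul_right, hl₁ s hs', hl₂ s hs', hc,
        hs]
      ring

end IsCircleFamily

/-! ### Infinitesimal rotations -/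

lemma hasDerivAt_axisRotation (p w x : E3) :
    HasDerivAt (fun θ => axisRotation p w θ x) (cross w (x - p)) 0 := by
  have h1 := (Real.hasDerivAt_cos 0).smul_const (x - p)
  have h2 := (Real.hasDerivAt_sin 0).smul_const (cross w (x - p))
  have h3 := (((Real.hasDerivAt_cos 0).const_sub 1).mul_const ⟪w, x - p⟫_ℝ).smul_const w
  refine (((h1.add h2).add h3).const_add p).congr_deriv ?_
  simp

/-- The velocity of a rotation that leaves a surface locally invariant is tangential. -/
lemma inner_cross_eq_zero_of_locally_invariant {X : ℝ → ℝ → E3} {I J : Set ℝ} {p w ν : E3}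
    {s t : ℝ} {L : ℝ × ℝ →L[ℝ] E3} (hL : HasStrictFDerivAt (Function.uncurry X) L (s, t))
    (hinj : Function.Injective L) (hν : ∀ x, ⟪L x, ν⟫_ℝ = 0)
    (hinv : ∀ U ∈ 𝓝 ((s, t) : ℝ × ℝ), ∀ᶠ θ in 𝓝 (0 : ℝ),
      axisRotation p w θ (X s t) ∈ Function.uncurry X '' (U ∩ I ×ˢ J)) :
    ⟪cross w (X s t - p), ν⟫_ℝ = 0 := by
  have hind : Topology.IsInducing L :=
    (LinearMap.isClosedEmbedding_of_injective (f := (L : ℝ × ℝ →ₗ[ℝ] E3))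
      (LinearMap.ker_eq_bot.2 hinj)).isInducing
  -- The parameters q of the rotated points need not depend continuously on θ. Since L is injective,
  -- however, |q − (s, t)| is controlled by |X(q) − X(s, t)|, so the component along ν is of smaller
  -- order than the displacement itself.
  have hrev := (HasFDerivAt.isThetaTVS_sub hL.hasFDerivAt hind).isTheta.2
  have h1 : (fun q => ⟪Function.uncurry X q - X s t, ν⟫_ℝ)
      =o[𝓝 (s, t)] fun q => Function.uncurry X q - X s t := by
    refine Asymptotics.IsLittleO.trans_isBigO ?_ hrev
    have h2 := hL.hasFDerivAt.isLittleO
    refine Asymptotics.IsBigO.trans_isLittleO ?_ h2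
    refine Asymptotics.IsBigO.of_bound ‖ν‖ (Filter.Eventually.of_forall fun q => ?_)
    have : ⟪Function.uncurry X q - X s t, ν⟫_ℝ
        = ⟪Function.uncurry X q - Function.uncurry X (s, t) - L (q - (s, t)), ν⟫_ℝ := by
      rw [inner_sub_left _ (L _), hν, sub_zero]
      rfl
    rw [this, mul_comm]
    exact norm_inner_le_norm _ _
  have hd := hasDerivAt_axisRotation p w (X s t)
  have h2 : (fun θ => ⟪axisRotation p w θ (X s t) - X s t, ν⟫_ℝ)
      =o[𝓝 0] fun θ => axisRotation p w θ (X s t) - X s t := by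
    rw [Asymptotics.isLittleO_iff] at h1 ⊢
    intro ε hε
    filter_upwards [hinv _ (h1 hε)] with θ hθ
    obtain ⟨q, hq, hqθ⟩ := hθ
    rw [← hqθ]
    exact hq.1
  have h3 : (fun θ => axisRotation p w θ (X s t) - X s t) =O[𝓝 0] fun θ : ℝ => θ - 0 := by
    have := hd.isBigO_sub
    rwa [axisRotation_zero] at this
  have h4 : HasDerivAt (fun θ => ⟪axisRotation p w θ (X s t) - X s t, ν⟫_ℝ) 0 0 := by
    rw [hasDerivAt_iff_isLittleO]
    simpa [axisRotation_zero] using h2.trans_isBigO h3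
  have h5 := ((hd.sub_const (X s t)).inner ℝ (hasDerivAt_const 0 ν)).unique h4
  simpa using h5

lemma quadratic_trig_coeffs {J : Set ℝ} (hJ : IsOpenInterval J) {a b c d e : ℝ}
    (h : ∀ t ∈ J, a + b * Real.cos t + c * Real.sin t + d * (Real.cos t * Real.sin t)
      + e * Real.cos t ^ 2 = 0) : b = 0 ∧ c = 0 ∧ d = 0 ∧ e = 0 := by
  have key := trig_coeffs_eq_zero hJ
    -- Coefficients of z⁰ to z⁴ after multiplication by z², padded with zeros to length nine.
    ![Complex.I * d / 4 + e / 4, b / 2 + Complex.I * c / 2, a + e / 2,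
      b / 2 - Complex.I * c / 2, -Complex.I * d / 4 + e / 4, 0, 0, 0, 0] (by
    intro t ht
    have h1 := congrArg (fun x : ℝ => (x : ℂ)) (h t ht)
    have hz : Complex.exp (t * Complex.I) ≠ 0 := Complex.exp_ne_zero _
    have hc : Complex.cos t
        = (Complex.exp (t * Complex.I) ^ 2 + 1) / (2 * Complex.exp (t * Complex.I)) := by
      rw [Complex.cos, neg_mul, Complex.exp_neg]; field_simp
    have hs : Complex.sin t = -Complex.I * (Complex.exp (t * Complex.I) ^ 2 - 1)
        / (2 * Complex.exp (t * Complex.I)) := by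
      rw [Complex.sin, neg_mul, Complex.exp_neg]; field_simp; ring
    push_cast at h1
    rw [hc, hs] at h1
    generalize Complex.exp (t * Complex.I) = z at h1 hz
    simp only [Fin.sum_univ_succ, Fin.sum_univ_zero]
    simp only [Matrix.cons_val_zero, Matrix.cons_val_succ, Fin.val_zero, Fin.val_succ]
    field_simp at h1
    linear_combination h1 / 4)
  have h0 := fun j => congrFun key j
  have e0 : Complex.I * d / 4 + e / 4 = 0 := h0 0
  have e1 : (b : ℂ) / 2 + Complex.I * c / 2 = 0 := h0 1
  have r0 := congrArg Complex.re e0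
  have i0 := congrArg Complex.im e0
  have r1 := congrArg Complex.re e1
  have i1 := congrArg Complex.im e1
  simp at r0 i0 r1 i1
  exact ⟨r1, i1, i0, r0⟩

/-! ### A non-rotational example -/

lemma IsOpenInterval.exists_antideriv {I : Set ℝ} (hI : IsOpenInterval I) {f : ℝ → ℝ}
    (hf : ContDiffOn ℝ ∞ f I) :
    ∃ F : ℝ → ℝ, ContDiffOn ℝ ∞ F I ∧ ∀ s ∈ I, HasDerivAt F (f s) s := by
  obtain ⟨s₀, hs₀⟩ := hI.nonempty
  have hd : ∀ s ∈ I, HasDerivAt (fun x => ∫ y in s₀..x, f y) (f s) s := fun s hs =>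
    intervalIntegral.integral_hasDerivAt_right
      ((hf.continuousOn.mono (hI.ordConnected.uIcc_subset hs₀ hs)).intervalIntegrable)
      (hf.continuousOn.stronglyMeasurableAtFilter hI.isOpen s hs)
      (hf.continuousOn.continuousAt (hI.isOpen.mem_nhds hs))
  refine ⟨_, ?_, hd⟩
  rw [contDiffOn_infty_iff_deriv_of_isOpen hI.isOpen]
  exact ⟨fun s hs => (hd s hs).differentiableAt.differentiableWithinAt,
    hf.congr fun s hs => (hd s hs).deriv⟩

lemma isFrame_standard : IsFrame (EuclideanSpace.single (0 : Fin 3) (1 : ℝ))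
    (EuclideanSpace.single (1 : Fin 3) (1 : ℝ)) (EuclideanSpace.single (2 : Fin 3) (1 : ℝ)) := by
  refine ⟨?_, ?_, ?_, ?_⟩
  · simp
  · simp
  · simp [inner_eq_coords]
  · apply E3.ext <;> simp [cross_apply_zero, cross_apply_one, cross_apply_two]

lemma isOpenInterval_Ioo {a b : ℝ} (h : a < b) : IsOpenInterval (Set.Ioo a b) :=
  ⟨isOpen_Ioo, Set.ordConnected_Ioo, Set.nonempty_Ioo.2 h⟩

/-- One of Riemann's minimal surfaces, swept out by circles and parametrized by their radii. -/
theorem exists_nonrotational_minimal {J : Set ℝ} (hJ : IsOpenInterval J) {φ : E3 → ℝ}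
    (hφ : ∀ p x, fderiv ℝ φ p x = 0) :
    ∃ (I : Set ℝ) (X : ℝ → ℝ → E3),
      IsCyclicSurface I J X ∧ IsWeightedMinimal φ I J X ∧ ¬ IsRotational I J X := by
  -- Riemann's equations with λ = 1 and C = 0 read r'² = r⁴ − 1, a' = r². With s = r as parameter, k
  -- = dz/ds = (s⁴ − 1)^(−1/2) and da/ds = s²k; any open interval inside (1, ∞) would serve.
  set I : Set ℝ := Set.Ioo 2 3 with hIdef
  have hI : IsOpenInterval I := isOpenInterval_Ioo (by norm_num)
  have hpos : ∀ s ∈ I, 0 < s ^ 4 - 1 := fun s hs => by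
    have : 2 < s := hs.1
    have h2 : (2 : ℝ) ^ 4 < s ^ 4 := pow_lt_pow_left₀ this (by norm_num) (by norm_num)
    linarith
  set k : ℝ → ℝ := fun s => (√(s ^ 4 - 1))⁻¹ with hk
  have hkpos : ∀ s ∈ I, 0 < k s := fun s hs => inv_pos.2 (Real.sqrt_pos.2 (hpos s hs))
  have hksq : ∀ s ∈ I, k s ^ 2 * (s ^ 4 - 1) = 1 := fun s hs => by
    rw [hk, inv_pow, Real.sq_sqrt (hpos s hs).le, inv_mul_cancel₀ (hpos s hs).ne']
  have hkc : ContDiffOn ℝ ∞ k I := by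
    refine ContDiffOn.inv (ContDiffOn.sqrt (by fun_prop) fun s hs => (hpos s hs).ne') fun s hs =>
      (Real.sqrt_pos.2 (hpos s hs)).ne'
  have hkd : ∀ s ∈ I, HasDerivAt k (-2 * s ^ 3 * k s ^ 3) s := fun s hs => by
    have hsq := (Real.sqrt_pos.2 (hpos s hs)).ne'
    have h1 : HasDerivAt (fun x : ℝ => x ^ 4 - 1) (4 * s ^ 3) s := by
      simpa using (hasDerivAt_pow 4 s).sub_const 1
    refine ((h1.sqrt (hpos s hs).ne').inv hsq).congr_deriv ?_
    simp only [hk]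
    field_simp
    ring
  obtain ⟨ζ, hζc, hζd⟩ := hI.exists_antideriv hkc
  obtain ⟨a, hac, had⟩ := hI.exists_antideriv (f := fun s => s ^ 2 * k s)
    ((contDiffOn_id.pow 2).mul hkc)
  have hfr := isFrame_standard
  set e₁ : E3 := EuclideanSpace.single (0 : Fin 3) (1 : ℝ) with he₁
  set e₂ : E3 := EuclideanSpace.single (1 : Fin 3) (1 : ℝ) with he₂
  set e₃ : E3 := EuclideanSpace.single (2 : Fin 3) (1 : ℝ) with he₃
  set c : ℝ → E3 := fun s => a s • e₁ + ζ s • e₃ with hc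
  set u : ℝ → E3 := fun _ => e₁ with hu
  set v : ℝ → E3 := fun _ => e₂ with hv
  have hfam : IsCircleFamily I c u v id := by
    refine ⟨hI.isOpen, (hac.smul contDiffOn_const).add (hζc.smul contDiffOn_const),
      contDiffOn_const, contDiffOn_const, contDiffOn_id, fun s hs => ?_, fun s _ => ?_⟩
    · have : 2 < s := hs.1
      simp only [id]
      linarith
    · rw [hfr.cross_ef]
      exact hfr
  set X : ℝ → ℝ → E3 := fun s t => c s + id s • radial u v t s with hXdef
  have hX : IsSweptBy I J c u v id X := fun s _ t _ => rfl
  have hn : planeNormal u v = fun _ => e₃ := by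
    funext s
    exact hfr.cross_ef
  have hc1 : ∀ s ∈ I, deriv c s = (s ^ 2 * k s) • e₁ + k s • e₃ := fun s hs =>
    (((had s hs).smul_const e₁).add ((hζd s hs).smul_const e₃)).deriv
  have hc2 : ∀ s ∈ I, deriv (deriv c) s = (2 * s * k s + s ^ 2 * (-2 * s ^ 3 * k s ^ 3)) • e₁
      + (-2 * s ^ 3 * k s ^ 3) • e₃ := fun s hs => by
    have h1 : deriv c =ᶠ[𝓝 s] fun s => (s ^ 2 * k s) • e₁ + k s • e₃ :=
      Filter.eventually_of_mem (hI.isOpen.mem_nhds hs) hc1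
    rw [h1.deriv_eq]
    have h2 : HasDerivAt (fun x : ℝ => x ^ 2) (2 * s) s := by simpa using hasDerivAt_pow 2 s
    exact (((h2.mul (hkd s hs)).smul_const e₁).add ((hkd s hs).smul_const e₃)).deriv
  have hA : ∀ s ∈ I, ∀ t ∈ J, ⟪partialS X s t, radial u v t s⟫_ℝ = 1 + s ^ 2 * k s * Real.cos t := by
    intro s hs t ht
    rw [hfam.inner_partialS_radial hX hs ht, hc1 s hs]
    simp only [radial, hu, hv, inner_add_left, inner_add_right, real_inner_smul_left,
      real_inner_smul_right, hfr.ee, hfr.ef, hfr.ne, hfr.nf, deriv_id]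
    ring
  have hB : ∀ s ∈ I, ∀ t ∈ J, ⟪partialS X s t, e₃⟫_ℝ = k s := by
    intro s hs t ht
    have := hfam.inner_partialS_planeNormal hX hs ht
    rw [hn, deriv_const, hc1 s hs] at this
    rw [this]
    simp only [inner_add_left, real_inner_smul_left, hfr.en, hfr.nn, inner_zero_right]
    ring
  have hli : ∀ s ∈ I, ∀ t ∈ J, LinearIndependent ℝ ![partialS X s t, partialT X s t] := by
    intro s hs t ht
    rw [hfam.linearIndependent_iff hX hJ.isOpen hs ht, hn, hB s hs t ht]
    have := hkpos s hs
    positivity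
  refine ⟨I, X, ⟨hI, hJ, ⟨c, u, v, id, hfam.center, hfam.fst, hfam.snd, hfam.radius,
    fun s hs => ⟨hfam.pos s hs, ?_, ?_, hfr.ef⟩, fun s _ t _ => rfl⟩, hli⟩, fun s hs => ?_, ?_⟩
  · simp [hu, he₁]
  · simp [hv, he₂]
  · rw [hfam.circleVanishing_iff (g := 0) hX hJ.isOpen (by simpa using hφ) hli hs,
      IsCircleFamily.CircleVanishing, hn]
    intro t _
    rw [hc1 s hs, hc2 s hs]
    have hid : deriv (id : ℝ → ℝ) = fun _ => 1 := by funext x; exact deriv_id x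
    simp only [hid, deriv_const, deriv_const', hu, hv, inner_add_left, real_inner_smul_left, hfr.ee, hfr.ef,
      hfr.en, hfr.ne, hfr.nf, hfr.nn, inner_zero_left, inner_zero_right, id, circleEquation]
    have h1 := hksq s hs
    have h2 := Real.sin_sq_add_cos_sq t
    linear_combination -k s * h1 + s ^ 4 * k s ^ 3 * h2
  · rintro ⟨p, w, hw, hinv⟩
    -- The vector A e₃ − B E, with E the radial direction, is normal to the surface, and the
    -- velocity of the rotation must be tangential.
    have tangent : ∀ s ∈ I, ∀ t ∈ J, ⟪cross w (X s t - p),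
        (1 + s ^ 2 * k s * Real.cos t) • e₃ - k s • radial u v t s⟫_ℝ = 0 := by
      intro s hs t ht
      obtain ⟨L, hL, hLx⟩ := hfam.exists_hasStrictFDerivAt hX hJ.isOpen hs ht
      refine inner_cross_eq_zero_of_locally_invariant hL ?_ (fun x => ?_) (hinv s hs t ht)
      · rw [injective_iff_map_eq_zero]
        intro x hx
        rw [hLx] at hx
        obtain ⟨h1, h2⟩ := LinearIndependent.pair_iff.1 (hli s hs t ht) _ _ hx
        exact Prod.ext h1 h2
      · have hf := hfam.frame_rotate t hs
        rw [hn] at hf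
        rw [hLx, IsCircleFamily.partialT_eq hX hJ.isOpen hs ht]
        simp only [inner_add_left, inner_sub_right, real_inner_smul_left, real_inner_smul_right,
          hA s hs t ht, hB s hs t ht, hf.fn, hf.fe]
        ring
    have hwz : ∀ s ∈ I, w 0 = 0 ∧ w 1 = 0 ∧ w 2 * (a s - p 0) = 0 := by
      intro s hs
      have hs2 : 2 < s := hs.1
      have hks := (hkpos s hs).ne'
      -- The terms cos t sin t and cos² t make the axis vertical. The term sin t then places the
      -- axis above the centre of each circle, although the centres drift.
      obtain ⟨-, h2, h3, h4⟩ := quadratic_trig_coeffs hJ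
        (a := -w 0 * p 1 - w 1 * (a s - p 0))
        (b := -k s * (w 1 * (ζ s - p 2) + w 2 * p 1) - w 1 * s
          + s ^ 2 * k s * (-w 0 * p 1 - w 1 * (a s - p 0)))
        (c := -k s * (w 2 * (a s - p 0) - w 0 * (ζ s - p 2)) + w 0 * s)
        (d := s ^ 2 * k s * w 0 * s) (e := -(s ^ 2 * k s * w 1 * s)) (fun t ht => by
          rw [← tangent s hs t ht, inner_eq_coords]
          simp [cross_apply_zero, cross_apply_one, cross_apply_two, hXdef, hc, radial, hu, hv,
            he₁, he₂, he₃]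
          ring)
      have hs0 : s ≠ 0 := by linarith
      have w0 : w 0 = 0 := by simpa [hs0, hks] using h3
      have w1 : w 1 = 0 := by simpa [hs0, hks] using h4
      refine ⟨w0, w1, ?_⟩
      rw [w0] at h2
      have : k s * (w 2 * (a s - p 0)) = 0 := by linear_combination -h2
      exact (mul_eq_zero.1 this).resolve_left hks
    obtain ⟨s₀, hs₀⟩ := hI.nonempty
    have hw2 : w 2 ≠ 0 := by
      intro h2
      have : w = 0 := E3.ext (hwz s₀ hs₀).1 (hwz s₀ hs₀).2.1 h2
      rw [this, norm_zero] at hw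
      exact zero_ne_one hw
    have ha : ∀ s ∈ I, a s = p 0 := fun s hs =>
      sub_eq_zero.1 ((mul_eq_zero.1 (hwz s hs).2.2).resolve_left hw2)
    have := (had s₀ hs₀).congr_on (hasDerivAt_const s₀ (p 0)) hI.isOpen hs₀ ha
    have hs2 : 2 < s₀ := hs₀.1
    have := hkpos s₀ hs₀
    have : 0 < s₀ ^ 2 * k s₀ := by positivity
    linarith

/-! ### The classification -/

lemma IsCyclicSurface.exists_family {I J : Set ℝ} {X : ℝ → ℝ → E3} (h : IsCyclicSurface I J X) :
    ∃ c u v ρ, IsCircleFamily I c u v ρ ∧ IsSweptBy I J c u v ρ X := by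
  obtain ⟨c, u, v, ρ, hc, hu, hv, hρ, hcirc, hX⟩ := h.circles
  refine ⟨c, u, v, ρ, ⟨h.interval_left.isOpen, hc, hu, hv, hρ, fun s hs => (hcirc s hs).1,
    fun s hs => ?_⟩, hX⟩
  obtain ⟨-, h1, h2, h3⟩ := hcirc s hs
  exact ⟨by rw [real_inner_self_eq_norm_sq, h1, one_pow],
    by rw [real_inner_self_eq_norm_sq, h2, one_pow], h3, rfl⟩

theorem IsCyclicSurface.classification {I J : Set ℝ} {X : ℝ → ℝ → E3} {φ : E3 → ℝ} {g : E3}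
    (hφ : ∀ p x, fderiv ℝ φ p x = ⟪g, x⟫_ℝ) (h : IsCyclicSurface I J X)
    (hmin : IsWeightedMinimal φ I J X) :
    IsRotational I J X ∨ (g = 0 ∧ IsRiemannExample I J X) := by
  obtain ⟨c, u, v, ρ, hfam, hX⟩ := h.exists_family
  have hI := h.interval_left
  have hJ := h.interval_right
  have H : ∀ s ∈ I, IsCircleFamily.CircleVanishing J c u v ρ g s := fun s hs =>
    (hfam.circleVanishing_iff hX hJ.isOpen hφ h.immersed hs).1 (hmin s hs)
  obtain ⟨s₀, hs₀⟩ := hI.nonempty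
  have hn : ∀ s ∈ I, planeNormal u v s = planeNormal u v s₀ := fun s hs =>
    hI.eq_of_deriv_eq_zero (fun x hx => (hfam.contDiffOn_planeNormal.hasDerivAt_deriv hI.isOpen
      hx).congr_deriv (hfam.deriv_planeNormal_eq_zero hJ H hx)) hs hs₀
  by_cases hg : g = 0
  · subst hg
    exact (hfam.isRotational_or_isRiemannExample hI hJ hX h.immersed hn H).imp id
      fun h' => ⟨rfl, h'⟩
  · exact Or.inl (hfam.isRotational_of_density_ne_zero hI hJ hX h.immersed hn H hg)

theorem corollary3 (J : Set ℝ) (hJ : IsOpenInterval J) (α β γ : ℝ) (φ : E3 → ℝ)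
    (hφ : ∀ p : E3, φ p = α * p 0 + β * p 1 + γ * p 2) :
    ((∃ (I : Set ℝ) (X : ℝ → ℝ → E3),
        IsCyclicSurface I J X ∧ IsWeightedMinimal φ I J X ∧ ¬ IsRotational I J X) ↔ φ = 0) ∧
    (φ = 0 → ∀ (I : Set ℝ) (X : ℝ → ℝ → E3),
      IsCyclicSurface I J X → IsWeightedMinimal φ I J X → ¬ IsRotational I J X →
        IsRiemannExample I J X) := by
  set g : E3 := !₂[α, β, γ] with hg
  have hφg : φ = innerSL ℝ g := by
    funext p
    rw [hφ, innerSL_apply_apply, inner_eq_coords]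
    simp [hg]
  have hd : ∀ p x, fderiv ℝ φ p x = ⟪g, x⟫_ℝ := fun p x => by
    rw [hφg, ContinuousLinearMap.fderiv, innerSL_apply_apply]
  refine ⟨⟨?_, ?_⟩, ?_⟩
  · rintro ⟨I, X, hX, hmin, hrot⟩
    have h0 := ((hX.classification hd hmin).resolve_left hrot).1
    rw [hφg, h0]
    funext p
    simp
  · rintro rfl
    exact exists_nonrotational_minimal hJ fun p x => by simp
  · rintro - I X hX hmin hrot
    exact ((hX.classification hd hmin).resolve_left hrot).2
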